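/- **Setting.** Let $\lambda\in\mathbb N$ be the security parameter and let $n:\mathbb N\to\mathbb N$ satisfy $n(\lambda)\ge\lambda+1$ for all $\lambda$; write $n=n(\lambda)$. The common Haar state $|\vartheta\rangle$ is a Haar-random $n$-qubit pure state $|\vartheta\rangle\leftarrow\mathcal H_n$, of which all parties receive copies (common Haar state (CHS) model). **The scheme.** Put $p=\lambda$ and $$|\psi_0\rangle=\frac1{\sqrt{2^\lambda}}\sum_{k\in\{0,1\}^\lambda}(Z^k\otimes I_{n-\lambda})|\vartheta\rangle_{\mathsf C}\,|k\|0^{n-\lambda}\rangle_{\mathsf R},\qquad |\psi_1\rangle=\frac1{\sqrt{2^n}}\sum_{j\in\{0,1\}^n}|j\rangle_{\mathsf C}|j\rangle_{\mathsf R}.$$ To commit to $b\in\{0,1\}$, the committer prepares $|\Psi_b\rangle_{\mathsf{CR}}=\bigotimes_{i=1}^p|\psi_b\rangle_{\mathsf C_i\mathsf R_i}$ and sends $\mathsf C=(\mathsf C_1,\dots,\mathsf C_p)$. To reveal, it sends $b$ and $\mathsf R=(\mathsf R_1,\dots,\mathsf R_p)$. The receiver prepares $|\Psi_b\rangle_{\mathsf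 C'\mathsf R'}$ from $p$ copies of $|\vartheta\rangle$, performs for every $i$ the SWAP test between $(\mathsf C_i,\mathsf R_i)$ and $(\mathsf C_i',\mathsf R_i')$, and outputs $b$ iff all tests accept (otherwise $\bot$). **Theorem.** 1. (Poly-copy statistical hiding.) For every polynomially bounded $t(\cdot)$ and every computationally unbounded non-uniform quantum algorithm $\mathcal A$ there is a negligible function $\mathrm{negl}$ such that for all $\lambda$ $$\Bigl|\Pr_{\vartheta\leftarrow\mathcal H_n}\bigl[\mathcal A(|\vartheta\rangle^{\otimes t},\mathrm{Tr}_{\mathsf R}|\Psi_0\rangle\langle\Psi_0|)=1\bigr]-\Pr_{\vartheta\leftarrow\mathcal H_n}\bigl[\mathcal A(|\vartheta\rangle^{\otimes t},\mathrm{Tr}_{\mathsf R}|\Psi_1\rangle\langle\Psi_1|)=1\bigr]\Bigr|\le\mathrm{negl}(\lambda).$$ 2. (Statistical sum-binding.) Let $T(\cdot)$ be an arbitrary function and let $C_0^*,C_1^*$ be computationally unbounded non-uniform malicious committers that take $|\vartheta\rangle^{\otimes T}$ as input and act identically in the commit phase: a common quantum channel turns $|\vartheta\rangle^{\otimes T}$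 into a state on $\mathsf C$ and a finite-dimensional internal register $\mathsf E$, and in the reveal phase $C_b^*$ applies a channel of its own from $\mathsf E$ to $\mathsf R$. Let $p_b$ be the probability, over $\vartheta\leftarrow\mathcal H_n$ and all measurements, that the receiver accepts the bit $b$ revealed by $C_b^*$. Then $p_0+p_1\le1+\mathrm{negl}(\lambda)$ for some negligible function $\mathrm{negl}$. 3. (Explicit bound.) Moreover, for every $\lambda$, every $T$ and every such pair of committers, $$p_0+p_1\le1+\left(\frac{1+2^{-(n-\lambda)/2}}2\right)^{\lambda}.$$ -/

import Mathlib

open scoped Kronecker BigOperators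

namespace CHS

noncomputable section

/-! Finite-dimensional quantum mechanics. A register is a finite type `X` of basis labels, its
Hilbert space is `X → ℂ`, and its operators are the square matrices over `X`. -/

/-- Basis labels of `n` qubits. -/
abbrev Qubits (n : ℕ) : Type := Fin n → Bool

/-- The basis vector `|x⟩`. -/
def ket {X : Type} [DecidableEq X] (x : X) : X → ℂ := Pi.single x 1

/-- The tensor product `u ⊗ v` of two vectors. -/
def tensor {X Y : Type} (u : X → ℂ) (v : Y → ℂ) : X × Y → ℂ := fun z => u z.1 * v z.2

/-- The operator `|u⟩⟨u|`. -/
def ketbra {X : Type} (u : X → ℂ) : Matrix X X ℂ := Matrix.vecMulVec u (star u)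

/-- The vector `u^{⊗ t}` on the `t`-fold register. -/
def copies {X : Type} (t : ℕ) (u : X → ℂ) : (Fin t → X) → ℂ := fun x => ∏ i, u (x i)

/-- The tensor power `A^{⊗ p}` of an operator. -/
def opPow {X : Type} (p : ℕ) (A : Matrix X X ℂ) : Matrix (Fin p → X) (Fin p → X) ℂ :=
  Matrix.of fun x y => ∏ i, A (x i) (y i)

/-- The partial trace over the second register. -/
def traceRight {X Y : Type} [Fintype Y] (ρ : Matrix (X × Y) (X × Y) ℂ) : Matrix X X ℂ :=
  Matrix.of fun x x' => ∑ y, ρ (x, y) (x', y)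

/-- A quantum channel (completely positive trace-preserving map) from register `X` to register `Y`,
given by Kraus operators. -/
structure Channel (X Y : Type) [Fintype X] [DecidableEq X] [Fintype Y] where
  rank : ℕ
  kraus : Fin rank → Matrix Y X ℂ
  trace_preserving : ∑ i, (kraus i).conjTranspose * kraus i = 1

/-- The output state of a channel. -/
def Channel.apply {X Y : Type} [Fintype X] [DecidableEq X] [Fintype Y] (Φ : Channel X Y)
    (ρ : Matrix X X ℂ) : Matrix Y Y ℂ :=
  ∑ i, Φ.kraus i * ρ * (Φ.kraus i).conjTranspose

/-- The output state of `id ⊗ Φ`, with `Φ` acting on the second register. -/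
def Channel.applyRight {W X Y : Type} [Fintype W] [DecidableEq W] [Fintype X] [DecidableEq X]
    [Fintype Y] (Φ : Channel X Y) (ρ : Matrix (W × X) (W × X) ℂ) :
    Matrix (W × Y) (W × Y) ℂ :=
  ∑ i, ((1 : Matrix W W ℂ) ⊗ₖ Φ.kraus i) * ρ * ((1 : Matrix W W ℂ) ⊗ₖ Φ.kraus i).conjTranspose

/-- Unit vectors of the `n`-qubit Hilbert space. -/
abbrev PureState (n : ℕ) : Type := Metric.sphere (0 : EuclideanSpace ℂ (Qubits n)) 1

/-- The amplitudes of an `n`-qubit pure state. -/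
def PureState.amp {n : ℕ} (θ : PureState n) : Qubits n → ℂ :=
  fun x => (θ : EuclideanSpace ℂ (Qubits n)) x

/-- The Haar distribution on `n`-qubit pure states: the normalized surface measure of the unit
sphere of `ℂ^{2^n}`. -/
def haar (n : ℕ) : MeasureTheory.Measure (PureState n) :=
  ((MeasureTheory.volume : MeasureTheory.Measure (EuclideanSpace ℂ (Qubits n))).toSphere
      Set.univ)⁻¹ •
    (MeasureTheory.volume : MeasureTheory.Measure (EuclideanSpace ℂ (Qubits n))).toSphere

/-! The commitment scheme. The security parameter is `l`, the common Haar state has `n` qubits, and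
`p = l` copies of it are used. -/

/-- The padded string `k || 0^{n-l}` (for `l ≤ n`). -/
def pad {l : ℕ} (n : ℕ) (k : Qubits l) : Qubits n :=
  fun i => if h : (i : ℕ) < l then k ⟨i, h⟩ else false

/-- The Pauli operator `Z^m = ⨂ᵢ Z^{mᵢ}` on `n` qubits. For `m = k || 0^{n-l}` this is
`Z^k ⊗ I_{n-l}`. -/
def pauliZ {n : ℕ} (m : Qubits n) : Matrix (Qubits n) (Qubits n) ℂ :=
  Matrix.diagonal fun x => ∏ i, if m i && x i then -1 else 1

/-- `|ψ₀⟩ = 2^{-l/2} ∑_k (Z^k ⊗ I_{n-l})|θ⟩ ⊗ |k || 0^{n-l}⟩`. -/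
def psi0 (l : ℕ) {n : ℕ} (θ : PureState n) : Qubits n × Qubits n → ℂ :=
  ((1 / Real.sqrt (2 ^ l) : ℝ) : ℂ) •
    ∑ k : Qubits l, tensor ((pauliZ (pad n k)).mulVec θ.amp) (ket (pad n k))

/-- `|ψ₁⟩ = 2^{-n/2} ∑_j |j⟩ ⊗ |j⟩`. -/
def psi1 (n : ℕ) : Qubits n × Qubits n → ℂ :=
  ((1 / Real.sqrt (2 ^ n) : ℝ) : ℂ) • ∑ j : Qubits n, tensor (ket j) (ket j)

/-- `|ψ_b⟩`, where `false` is the bit 0 and `true` is the bit 1. -/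
def psi (l : ℕ) {n : ℕ} (b : Bool) (θ : PureState n) : Qubits n × Qubits n → ℂ :=
  if b then psi1 n else psi0 l θ

/-- The register `C = (C₁, …, C_p)` (and likewise `R`), with `p = l`. -/
abbrev Reg (l n : ℕ) : Type := Fin l → Qubits n

/-- The state `|Ψ_b⟩ = ⨂ᵢ |ψ_b⟩_{CᵢRᵢ}` prepared by the committer in the commit phase. -/
def commitState (l : ℕ) {n : ℕ} (b : Bool) (θ : PureState n) : Reg l n × Reg l n → ℂ :=
  fun z => ∏ i, psi l b θ (z.1 i, z.2 i)

/-- The Hadamard gate. -/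
def hadamard : Matrix Bool Bool ℂ :=
  Matrix.of fun a b => ((1 / Real.sqrt 2 : ℝ) : ℂ) * if a && b then -1 else 1

/-- The controlled swap of two registers of the same kind. -/
def controlledSwap (X : Type) [DecidableEq X] :
    Matrix (Bool × (X × X)) (Bool × (X × X)) ℂ :=
  Matrix.of fun s s' => if s = (s'.1, if s'.1 then s'.2.swap else s'.2) then 1 else 0

/-- The circuit of the SWAP test between two registers, the first qubit being the ancilla. The
ancilla starts in `|0⟩`, and the test accepts iff it is measured to be `0` at the end. -/
def swapTest (X : Type) [Fintype X] [DecidableEq X] :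
    Matrix (Bool × (X × X)) (Bool × (X × X)) ℂ :=
  (hadamard ⊗ₖ (1 : Matrix (X × X) (X × X) ℂ)) * controlledSwap X *
    (hadamard ⊗ₖ (1 : Matrix (X × X) (X × X) ℂ))

/-- For each `i`, the ancilla of the `i`-th SWAP test, `(Cᵢ, Rᵢ)` and `(C'ᵢ, R'ᵢ)`. -/
abbrev TestReg (l n : ℕ) : Type :=
  Fin l → Bool × ((Qubits n × Qubits n) × (Qubits n × Qubits n))

/-- The receiver's joint state `|0⟩⟨0|^{⊗ p} ⊗ ρ_{CR} ⊗ |Ψ_b⟩⟨Ψ_b|_{C'R'}` before the tests. -/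
def testInput (l : ℕ) {n : ℕ} (b : Bool) (θ : PureState n)
    (ρ : Matrix (Reg l n × Reg l n) (Reg l n × Reg l n) ℂ) :
    Matrix (TestReg l n) (TestReg l n) ℂ :=
  Matrix.of fun s s' =>
    ketbra (copies l (ket false)) (fun i => (s i).1) (fun i => (s' i).1) *
    ρ (fun i => (s i).2.1.1, fun i => (s i).2.1.2)
      (fun i => (s' i).2.1.1, fun i => (s' i).2.1.2) *
    ketbra (commitState l b θ) (fun i => (s i).2.2.1, fun i => (s i).2.2.2)
      (fun i => (s' i).2.2.1, fun i => (s' i).2.2.2)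

/-- The probability that the receiver, holding `ρ` on the registers `C, R` after bit `b` has been
revealed, accepts: all `p` SWAP tests between `(Cᵢ, Rᵢ)` and `(C'ᵢ, R'ᵢ)` accept. -/
def acceptProb (l : ℕ) {n : ℕ} (b : Bool) (θ : PureState n)
    (ρ : Matrix (Reg l n × Reg l n) (Reg l n × Reg l n) ℂ) : ℝ :=
  (∑ s : TestReg l n, if ∀ i, (s i).1 = false then
    (opPow l (swapTest (Qubits n × Qubits n)) * testInput l b θ ρ *
      (opPow l (swapTest (Qubits n × Qubits n))).conjTranspose) s s else 0).re

/-! Security. -/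

/-- Negligible functions of the security parameter. -/
def Negligible (f : ℕ → ℝ) : Prop :=
  Asymptotics.SuperpolynomialDecay Filter.atTop (fun l : ℕ => (l : ℝ)) f

/-- Polynomially bounded functions of the security parameter. -/
def PolyBounded (t : ℕ → ℕ) : Prop := ∃ q : Polynomial ℕ, ∀ l, t l ≤ q.eval l

/-- The probability that the distinguisher `A` outputs 1 on `t` copies of the common Haar state and
the register `C` of an honest commitment to `b`. -/
def hidingProb (l : ℕ) {n t : ℕ} (A : Channel ((Fin t → Qubits n) × Reg l n) Bool) (b : Bool) : ℝ :=
  ∫ θ : PureState n,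
    (A.apply (ketbra (copies t θ.amp) ⊗ₖ traceRight (ketbra (commitState l b θ))) true true).re
    ∂(haar n)

/-- Poly-copy statistical hiding of the scheme with an `n(l)`-qubit common Haar state. -/
def PolyCopyStatisticallyHiding (n : ℕ → ℕ) : Prop :=
  ∀ t : ℕ → ℕ, PolyBounded t →
  ∀ A : ∀ l, Channel ((Fin (t l) → Qubits (n l)) × Reg l (n l)) Bool,
  ∃ negl : ℕ → ℝ, Negligible negl ∧
    ∀ l, |hidingProb l (A l) false - hidingProb l (A l) true| ≤ negl l

/-- A pair of malicious committers `C₀*`, `C₁*` that work in the same way in the commit phase: from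
`T` copies of the common Haar state they produce the register `C` and an internal register of some
dimension, and to reveal `b` the committer `C_b*` turns its internal register into the register
`R`. -/
structure MaliciousPair (l n T : ℕ) where
  dim : ℕ
  commit : Channel (Fin T → Qubits n) (Reg l n × Fin dim)
  reveal : Bool → Channel (Fin dim) (Reg l n)

/-- The state on the registers `C, R` that the receiver gets from `C_b*`. -/
def MaliciousPair.state {l n T : ℕ} (M : MaliciousPair l n T) (b : Bool) (θ : PureState n) :
    Matrix (Reg l n × Reg l n) (Reg l n × Reg l n) ℂ :=
  (M.reveal b).applyRight (M.commit.apply (ketbra (copies T θ.amp)))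

/-- The probability `p_b` that the receiver accepts the bit `b` revealed by `C_b*`. -/
def bindingProb {l n T : ℕ} (M : MaliciousPair l n T) (b : Bool) : ℝ :=
  ∫ θ : PureState n, acceptProb l b θ (M.state b θ) ∂(haar n)

/-- Statistical sum-binding of the scheme with an `n(l)`-qubit common Haar state. -/
def StatisticallySumBinding (n : ℕ → ℕ) : Prop :=
  ∀ T : ℕ → ℕ, ∀ M : ∀ l, MaliciousPair l (n l) (T l),
  ∃ negl : ℕ → ℝ, Negligible negl ∧
    ∀ l, bindingProb (M l) false + bindingProb (M l) true ≤ 1 + negl l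

end

end CHS

namespace CHS

noncomputable section

open MeasureTheory

/-! ### The Haar measure on pure states -/

/-! Hiding. Tracing out `R` averages `Z^k` over all `k`, which dephases the common state in its
first `l` bits; the other commitment is maximally mixed. A distinguisher is linear, so it sees only
the Haar average of its `t + l` registers (`hidingProb_eq`). Phase invariance of the Haar measure
kills every entry whose row and column strings form different sets, and permutation invariance makes
the remaining entries equal as long as the strings are distinct. Call a label good if its `t + l`
strings have pairwise distinct prefixes. On good labels dephasing then pins every committed string,
so both averaged states are multiples of one block matrix and have no coherence with bad labels
(`exists_avgState_eq`). Hence the advantage is at most twice the larger bad weight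
(`Channel.distinguish_le`). That weight is a collision probability, controlled by the second moments
`E|θ_x|²|θ_y|²` (`integral_collision_le`) and a union bound over pairs of positions.

Binding. A SWAP test against a pure `ψ` is the effect `(1 + |ψ⟩⟨ψ|)/2`. Expanding the product of the
`l` tests over subsets `S` gives `2^{-l}` times a sum of probabilities of projecting exactly the
registers in `S` onto `ψ_b` (`acceptProb_eq_sum_overlap`). For fixed `S` the two probabilities add
up to at most `1 + s^{|S|}` with `s = 2^{-(n-l)/2}` (`overlap_sum_le`): the `R` half of `ψ₀` lives
on `2^l` of the `2^n` labels, `ψ₁` is maximally entangled, and local operations on the revealing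
side cannot increase their overlap beyond `s` per register. The binomial theorem sums this to `1 +
((1 + s)/2)^l`. The estimate holds for every fixed `θ`, so the number of copies given to the
committer plays no role. -/

instance haar_isProbabilityMeasure (n : ℕ) : IsProbabilityMeasure (haar n) := by
  have hne : (volume : Measure (EuclideanSpace ℂ (Qubits n))).toSphere Set.univ ≠ 0 := by
    rw [Ne, Measure.measure_univ_eq_zero]
    exact Measure.toSphere_ne_zero _
  refine ⟨?_⟩
  rw [haar, Measure.smul_apply, smul_eq_mul]
  exact ENNReal.inv_mul_cancel hne (measure_ne_top _ _)

/-- The action of a linear isometry on pure states. -/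
def actOnSphere {n : ℕ}
    (L : EuclideanSpace ℂ (Qubits n) ≃ₗᵢ[ℝ] EuclideanSpace ℂ (Qubits n)) (θ : PureState n) :
    PureState n :=
  ⟨L θ, by simp⟩

theorem continuous_actOnSphere {n : ℕ}
    (L : EuclideanSpace ℂ (Qubits n) ≃ₗᵢ[ℝ] EuclideanSpace ℂ (Qubits n)) :
    Continuous (actOnSphere L) :=
  Continuous.subtype_mk (L.continuous.comp continuous_subtype_val) _

-- The spherical measure of `s` is a multiple of the volume of the open cone over `s`. Cones commute
-- with `L`, and `L` preserves volume.
open scoped Pointwise in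
theorem measurePreserving_toSphere {n : ℕ}
    (L : EuclideanSpace ℂ (Qubits n) ≃ₗᵢ[ℝ] EuclideanSpace ℂ (Qubits n)) :
    MeasurePreserving (actOnSphere L)
      (volume : Measure (EuclideanSpace ℂ (Qubits n))).toSphere
      (volume : Measure (EuclideanSpace ℂ (Qubits n))).toSphere := by
  have hm : Measurable (actOnSphere L) := (continuous_actOnSphere L).measurable
  refine ⟨hm, ?_⟩
  ext s hs
  rw [Measure.map_apply hm hs, Measure.toSphere_apply' _ (hm hs), Measure.toSphere_apply' _ hs]
  congr 1
  have hset : Set.Ioo (0 : ℝ) 1 • (((↑) : PureState n → EuclideanSpace ℂ (Qubits n)) ''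
      (actOnSphere L ⁻¹' s)) = L ⁻¹' (Set.Ioo (0 : ℝ) 1 • (((↑) : PureState n →
        EuclideanSpace ℂ (Qubits n)) '' s)) := by
    ext v
    simp only [Set.mem_smul, Set.mem_image, Set.mem_preimage]
    constructor
    · rintro ⟨r, hr, _, ⟨θ, hθ, rfl⟩, rfl⟩
      exact ⟨r, hr, _, ⟨_, hθ, rfl⟩, by simp [actOnSphere]⟩
    · rintro ⟨r, hr, _, ⟨θ, hθ, rfl⟩, h⟩
      refine ⟨r, hr, _, ⟨actOnSphere L.symm θ, ?_, rfl⟩, ?_⟩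
      · have : actOnSphere L (actOnSphere L.symm θ) = θ := by
          ext1; simp [actOnSphere]
        rwa [this]
      · apply L.injective
        simp [actOnSphere, h]
  rw [hset]
  exact (L.measurePreserving).measure_preimage_equiv (f := L.toMeasurableEquiv) _

theorem integral_haar_act {n : ℕ} {E : Type*} [NormedAddCommGroup E] [NormedSpace ℝ E]
    (L : EuclideanSpace ℂ (Qubits n) ≃ₗᵢ[ℝ] EuclideanSpace ℂ (Qubits n)) {f : PureState n → E}
    (hf : Continuous f) :
    ∫ θ, f (actOnSphere L θ) ∂(haar n) = ∫ θ, f θ ∂(haar n) := by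
  have h : MeasurePreserving (actOnSphere L) (haar n) (haar n) :=
    (measurePreserving_toSphere L).smul_measure _
  conv_rhs => rw [← h.map_eq]
  rw [integral_map h.measurable.aemeasurable hf.aestronglyMeasurable]

theorem integrable_haar {n : ℕ} {E : Type*} [NormedAddCommGroup E]
    {f : PureState n → E} (hf : Continuous f) : Integrable f (haar n) := by
  have : IsFiniteMeasureOnCompacts (haar n) := inferInstance
  exact hf.integrable_of_hasCompactSupport (HasCompactSupport.of_compactSpace f)

@[fun_prop]
theorem continuous_amp {n : ℕ} (x : Qubits n) : Continuous fun θ : PureState n => θ.amp x := by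
  unfold PureState.amp
  fun_prop

theorem sum_norm_amp_sq {n : ℕ} (θ : PureState n) : ∑ x, ‖θ.amp x‖ ^ 2 = 1 := by
  have h : ‖(θ : EuclideanSpace ℂ (Qubits n))‖ = 1 := by
    simp
  have := EuclideanSpace.norm_sq_eq (θ : EuclideanSpace ℂ (Qubits n))
  rw [h] at this
  simpa [PureState.amp] using this.symm

/-! ### Moments of the Haar measure -/

/-- Permutation of the amplitudes. -/
theorem integral_haar_perm {n : ℕ} {E : Type*} [NormedAddCommGroup E] [NormedSpace ℝ E]
    (e : Equiv.Perm (Qubits n)) {f : (Qubits n → ℂ) → E} (hf : Continuous f) :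
    ∫ θ : PureState n, f (θ.amp ∘ e) ∂(haar n) = ∫ θ : PureState n, f θ.amp ∂(haar n) := by
  have hc : Continuous fun θ : PureState n => f θ.amp :=
    hf.comp (continuous_pi fun x => continuous_amp x)
  rw [← integral_haar_act (LinearIsometryEquiv.piLpCongrLeft 2 ℝ ℂ e.symm) hc]
  refine integral_congr_ae (.of_forall fun θ => ?_)
  congr 1

/-- Multiplication of the amplitudes by phases. -/
theorem integral_haar_phase {n : ℕ} {E : Type*} [NormedAddCommGroup E] [NormedSpace ℝ E]
    (c : Qubits n → Circle) {f : (Qubits n → ℂ) → E} (hf : Continuous f) :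
    ∫ θ : PureState n, f (fun x => c x * θ.amp x) ∂(haar n) =
      ∫ θ : PureState n, f θ.amp ∂(haar n) := by
  have hc : Continuous fun θ : PureState n => f θ.amp :=
    hf.comp (continuous_pi fun x => continuous_amp x)
  rw [← integral_haar_act (LinearIsometryEquiv.piLpCongrRight 2 fun x => rotation (c x)) hc]
  refine integral_congr_ae (.of_forall fun θ => ?_)
  congr 1

/-- The Hadamard rotation of two coordinates. -/
def hadamardPair {X : Type} [Fintype X] [DecidableEq X] (x y : X) :
    EuclideanSpace ℂ X →ₗ[ℝ] EuclideanSpace ℂ X where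
  toFun v := WithLp.toLp 2 fun z => if z = x then ((√2)⁻¹ : ℝ) * (v x + v y) else
    if z = y then ((√2)⁻¹ : ℝ) * (v x - v y) else v z
  map_add' u v := by
    ext z
    simp only [PiLp.add_apply]
    split_ifs <;> ring
  map_smul' r v := by
    ext z
    simp only [PiLp.smul_apply, RingHom.id_apply, Complex.real_smul]
    split_ifs <;> ring

theorem norm_add_sq_add_norm_sub_sq (a b : ℂ) :
    ‖(((√2)⁻¹ : ℝ) : ℂ) * (a + b)‖ ^ 2 + ‖(((√2)⁻¹ : ℝ) : ℂ) * (a - b)‖ ^ 2 =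
      ‖a‖ ^ 2 + ‖b‖ ^ 2 := by
  have := parallelogram_law_with_norm ℝ a b
  simp only [norm_mul, mul_pow, Complex.norm_real, norm_inv, Real.norm_eq_abs, sq_abs,
    inv_pow, Real.sq_sqrt zero_le_two]
  nlinarith

theorem norm_hadamardPair {X : Type} [Fintype X] [DecidableEq X] {x y : X} (h : x ≠ y)
    (v : EuclideanSpace ℂ X) : ‖hadamardPair x y v‖ = ‖v‖ := by
  rw [← sq_eq_sq₀ (norm_nonneg _) (norm_nonneg _), EuclideanSpace.norm_sq_eq,
    EuclideanSpace.norm_sq_eq, ← sub_eq_zero, ← Finset.sum_sub_distrib,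
    ← Finset.sum_subset (Finset.subset_univ {x, y}), Finset.sum_pair h]
  · have := norm_add_sq_add_norm_sub_sq (v x) (v y)
    simp only [hadamardPair, LinearMap.coe_mk, AddHom.coe_mk, if_true, h.symm, if_false]
    linarith
  · intro z _ hz
    simp only [Finset.mem_insert, Finset.mem_singleton, not_or] at hz
    simp [hadamardPair, hz.1, hz.2]

/-- The Haar expectation of `|θ_x|² |θ_y|²`. -/
def moment {n : ℕ} (x y : Qubits n) : ℝ :=
  ∫ θ : PureState n, ‖θ.amp x‖ ^ 2 * ‖θ.amp y‖ ^ 2 ∂(haar n)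

theorem moment_nonneg {n : ℕ} (x y : Qubits n) : 0 ≤ moment x y :=
  integral_nonneg fun θ => by positivity

theorem moment_perm {n : ℕ} (e : Equiv.Perm (Qubits n)) (x y : Qubits n) :
    moment (e x) (e y) = moment x y :=
  integral_haar_perm (f := fun v : Qubits n → ℂ => ‖v x‖ ^ 2 * ‖v y‖ ^ 2) e (by fun_prop)

/-- Permutations act doubly transitively on the strings: one transposition moves `x` to `x'`, a
second corrects the image of `y` without moving `x'`. -/
theorem moment_eq_of_ne {n : ℕ} {x y x' y' : Qubits n} (h : x ≠ y) (h' : x' ≠ y') :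
    moment x y = moment x' y' := by
  have h1 : Equiv.swap x x' y ≠ x' := by
    rw [Ne, Equiv.swap_apply_eq_iff, Equiv.swap_apply_right]
    exact h.symm
  rw [← moment_perm ((Equiv.swap x x').trans (Equiv.swap (Equiv.swap x x' y) y'))]
  simp only [Equiv.trans_apply, Equiv.swap_apply_left]
  rw [Equiv.swap_apply_of_ne_of_ne h1.symm h']

theorem sum_moment {n : ℕ} : ∑ x : Qubits n, ∑ y, moment x y = 1 := by
  have hi (x y : Qubits n) :
      Integrable (fun θ : PureState n => ‖θ.amp x‖ ^ 2 * ‖θ.amp y‖ ^ 2) (haar n) :=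
    integrable_haar (by fun_prop)
  simp only [moment]
  simp_rw [← integral_finsetSum _ fun y _ => hi _ y]
  rw [← integral_finsetSum _ fun x _ => integrable_finsetSum _ fun y _ => hi x y]
  simp [← Finset.mul_sum, sum_norm_amp_sq]

/-- Multiplying the amplitude at `y` by `i` exchanges the squares of the real and imaginary parts of
`θ_x conj θ_y`, so both have the same mean; together they make up `|θ_x|²|θ_y|²`. -/
theorem integral_re_sq {n : ℕ} {x y : Qubits n} (h : x ≠ y) :
    2 * ∫ θ : PureState n, (θ.amp x * star (θ.amp y)).re ^ 2 ∂(haar n) = moment x y := by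
  have h1 := integral_haar_phase
    (Function.update 1 y (Circle.exp (Real.pi / 2)))
    (f := fun v : Qubits n → ℂ => (v x * star (v y)).re ^ 2) (by fun_prop)
  have h2 : (fun θ : PureState n => ((θ.amp x * star (θ.amp y)).im ^ 2)) =
      fun θ : PureState n => (fun v : Qubits n → ℂ => (v x * star (v y)).re ^ 2)
        (fun z => (Function.update 1 y (Circle.exp (Real.pi / 2)) : Qubits n → Circle) z
          * θ.amp z) := by
    funext θ
    have : ((Circle.exp (Real.pi / 2) : Circle) : ℂ) = Complex.I := by
      rw [Circle.coe_exp]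
      push_cast
      exact Complex.exp_pi_div_two_mul_I
    simp only [Function.update_self, Function.update_of_ne h, this, Pi.one_apply, Circle.coe_one]
    simp
    ring
  rw [← h2] at h1
  rw [two_mul]
  nth_rewrite 1 [← h1]
  rw [← integral_add (integrable_haar (by fun_prop)) (integrable_haar (by fun_prop)), moment]
  refine integral_congr_ae (.of_forall fun θ => ?_)
  simp only [← Complex.normSq_eq_norm_sq]
  simp only [Complex.normSq_apply, Complex.mul_re, Complex.mul_im, Complex.star_def,
    Complex.conj_re, Complex.conj_im]
  ring

/-- With `a = θ_x` and `b = θ_y`, Hadamard invariance turns `E|a|²|b|²` into `E|a² - b²|²/4`.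
Expanding this as `((|a|² + |b|²)² - 4 (Re a conj b)²)/4` leaves a linear relation between the two
moments. -/
theorem moment_self {n : ℕ} {x y : Qubits n} (h : x ≠ y) : moment x x = 2 * moment x y := by
  have hxx : moment y y = moment x x := by
    simpa using moment_perm (Equiv.swap x y) x x
  have key : moment x y = ∫ θ : PureState n, (4⁻¹ * (‖θ.amp x‖ ^ 2 * ‖θ.amp x‖ ^ 2 +
      ‖θ.amp y‖ ^ 2 * ‖θ.amp y‖ ^ 2 + 2 * (‖θ.amp x‖ ^ 2 * ‖θ.amp y‖ ^ 2)) -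
      (θ.amp x * star (θ.amp y)).re ^ 2) ∂(haar n) := by
    let L : EuclideanSpace ℂ (Qubits n) ≃ₗᵢ[ℝ] EuclideanSpace ℂ (Qubits n) :=
      LinearIsometry.toLinearIsometryEquiv ⟨hadamardPair x y, norm_hadamardPair h⟩ rfl
    rw [moment, ← integral_haar_act L (by fun_prop)]
    refine integral_congr_ae (.of_forall fun θ => ?_)
    have e1 : (actOnSphere L θ).amp x = ((√2)⁻¹ : ℝ) * (θ.amp x + θ.amp y) := by
      simp [L, actOnSphere, PureState.amp, hadamardPair]
    have e2 : (actOnSphere L θ).amp y = ((√2)⁻¹ : ℝ) * (θ.amp x - θ.amp y) := by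
      simp [L, actOnSphere, PureState.amp, hadamardPair, h.symm]
    simp only [e1, e2, norm_mul, mul_pow, Complex.norm_real, norm_inv, Real.norm_eq_abs, sq_abs,
      inv_pow, Real.sq_sqrt zero_le_two]
    simp only [← Complex.normSq_eq_norm_sq]
    simp only [Complex.normSq_apply, Complex.mul_re, Complex.star_def,
      Complex.conj_re, Complex.conj_im, Complex.add_re, Complex.add_im, Complex.sub_re,
      Complex.sub_im]
    ring
  rw [integral_sub (integrable_haar (by fun_prop)) (integrable_haar (by fun_prop)),
    integral_const_mul, integral_add (integrable_haar (by fun_prop))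
    (integrable_haar (by fun_prop)), integral_add (integrable_haar (by fun_prop))
    (integrable_haar (by fun_prop)), integral_const_mul] at key
  have := integral_re_sq h
  change moment x y = 4⁻¹ * (moment x x + moment y y + 2 * moment x y) - _ at key
  linarith

/-! ### The reduced states of the commitments -/

/-- The first `l` bits of a string. -/
def pre {l n : ℕ} (h : l ≤ n) (x : Qubits n) : Qubits l := fun i => x (Fin.castLE h i)

theorem pre_pad {l n : ℕ} (h : l ≤ n) (k : Qubits l) : pre h (pad n k) = k := by
  funext i
  simp [pre, pad]

theorem pad_injective {l n : ℕ} (h : l ≤ n) :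
    Function.Injective (pad n : Qubits l → Qubits n) :=
  Function.LeftInverse.injective (pre_pad h)

/-- The character `(-1)^{⟨m, x⟩}`. -/
def sign {n : ℕ} (m x : Qubits n) : ℂ := ∏ i, if m i && x i then -1 else 1

theorem sign_pad {l n : ℕ} (h : l ≤ n) (k : Qubits l) (x : Qubits n) :
    sign (pad n k) x = sign k (pre h x) := by
  obtain ⟨m, rfl⟩ := Nat.exists_eq_add_of_le h
  rw [sign, Fin.prod_univ_add]
  simp only [pad, Fin.val_castAdd, Fin.is_lt, dite_true, Fin.val_natAdd]
  simp only [add_lt_iff_neg_left, not_lt_zero, dite_false, Bool.false_and, Bool.false_eq_true,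
    if_false, Finset.prod_const_one, mul_one]
  rfl

theorem star_sign {n : ℕ} (m x : Qubits n) : star (sign m x) = sign m x := by
  rw [sign, star_prod]
  refine Finset.prod_congr rfl fun i _ => ?_
  split_ifs <;> simp

/-- Orthogonality of characters: the sum over `k` factors over the bits, and a bit where `a` and `b`
differ contributes `1 - 1 = 0`. -/
theorem sum_sign_mul_sign {l : ℕ} (a b : Qubits l) :
    ∑ k : Qubits l, sign k a * sign k b = if a = b then 2 ^ l else 0 := by
  have h (k : Qubits l) : sign k a * sign k b =
      ∏ i, (if k i && a i then (-1 : ℂ) else 1) * (if k i && b i then (-1 : ℂ) else 1) := by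
    rw [sign, sign, Finset.prod_mul_distrib]
  simp_rw [h]
  have h2 := Finset.prod_univ_sum (fun _ : Fin l => (Finset.univ : Finset Bool))
    (fun i c => (if c && a i then (-1 : ℂ) else 1) * (if c && b i then (-1 : ℂ) else 1))
  rw [Fintype.piFinset_univ] at h2
  rw [← h2]
  have h3 (i : Fin l) : ∑ c : Bool, (if c && a i then (-1 : ℂ) else 1) *
      (if c && b i then (-1 : ℂ) else 1) = if a i = b i then 2 else 0 := by
    cases a i <;> cases b i <;> norm_num
  simp_rw [h3]
  split_ifs with hab
  · simp [hab]
  · obtain ⟨i, hi⟩ := Function.ne_iff.1 hab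
    exact Finset.prod_eq_zero (Finset.mem_univ i) (by simp [hi])

theorem psi0_apply {l n : ℕ} (θ : PureState n) (c r : Qubits n) :
    psi0 l θ (c, r) = ((1 / √(2 ^ l) : ℝ) : ℂ) * ∑ k : Qubits l,
      if r = pad n k then sign (pad n k) c * θ.amp c else 0 := by
  simp [psi0, tensor, ket, pauliZ, Matrix.mulVec_diagonal, sign, Pi.single_apply]

theorem psi1_apply {n : ℕ} (c r : Qubits n) :
    psi1 n (c, r) = if c = r then ((1 / √(2 ^ n) : ℝ) : ℂ) else 0 := by
  simp [psi1, tensor, ket, Pi.single_apply, Finset.sum_ite_eq]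

theorem inv_sqrt_two_pow_mul_self (l : ℕ) :
    ((1 / √(2 ^ l) : ℝ) : ℂ) * ((1 / √(2 ^ l) : ℝ) : ℂ) = ((2 : ℂ) ^ l)⁻¹ := by
  rw [← Complex.ofReal_mul, div_mul_div_comm, one_mul, Real.mul_self_sqrt (by positivity)]
  simp

/-- The padded keys in `R` are orthogonal, so the trace leaves the uniform mixture of the states
`Z^k θ`, and averaging the signs dephases the prefix. -/
theorem sum_psi0_mul_star {l n : ℕ} (h : l ≤ n) (θ : PureState n) (c c' : Qubits n) :
    ∑ r, psi0 l θ (c, r) * star (psi0 l θ (c', r)) =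
      if pre h c = pre h c' then θ.amp c * star (θ.amp c') else 0 := by
  have h1 (r : Qubits n) : psi0 l θ (c, r) * star (psi0 l θ (c', r)) =
      ((2 : ℂ) ^ l)⁻¹ * (θ.amp c * star (θ.amp c')) * ∑ k : Qubits l,
        if r = pad n k then sign k (pre h c) * sign k (pre h c') else 0 := by
    rw [psi0_apply, psi0_apply, ← inv_sqrt_two_pow_mul_self]
    simp only [star_mul', star_sum, Complex.star_def, Complex.conj_ofReal, sign_pad h]
    by_cases hr : ∃ k : Qubits l, r = pad n k
    · obtain ⟨k, rfl⟩ := hr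
      simp only [(pad_injective h).eq_iff, Finset.sum_ite_eq, Finset.mem_univ, if_true,
        apply_ite (starRingEnd ℂ), map_mul, map_zero]
      simp only [← Complex.star_def, star_sign]
      ring
    · simp only [not_exists] at hr
      simp [hr]
  simp_rw [h1]
  rw [← Finset.mul_sum, Finset.sum_comm]
  simp only [Finset.sum_ite_eq', Finset.mem_univ, if_true, sum_sign_mul_sign]
  split_ifs with hc
  · field_simp
  · simp

theorem sum_psi1_mul_star {n : ℕ} (c c' : Qubits n) :
    ∑ r, psi1 n (c, r) * star (psi1 n (c', r)) = if c = c' then ((2 : ℂ) ^ n)⁻¹ else 0 := by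
  simp only [psi1_apply, ← inv_sqrt_two_pow_mul_self n]
  simp [apply_ite (starRingEnd ℂ)]

theorem traceRight_commitState {l n : ℕ} (b : Bool) (θ : PureState n) (c c' : Reg l n) :
    traceRight (ketbra (commitState l b θ)) c c' =
      ∏ j, ∑ r, psi l b θ (c j, r) * star (psi l b θ (c' j, r)) := by
  rw [Finset.prod_univ_sum, Fintype.piFinset_univ]
  simp [traceRight, ketbra, commitState, Matrix.vecMulVec_apply, Finset.prod_mul_distrib]

theorem traceRight_commitState_false {l n : ℕ} (h : l ≤ n) (θ : PureState n) (c c' : Reg l n) :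
    traceRight (ketbra (commitState l false θ)) c c' =
      ∏ j, if pre h (c j) = pre h (c' j) then θ.amp (c j) * star (θ.amp (c' j)) else 0 := by
  simp only [traceRight_commitState, psi, Bool.false_eq_true, if_false, sum_psi0_mul_star h]

theorem traceRight_commitState_true {l n : ℕ} (θ : PureState n) (c c' : Reg l n) :
    traceRight (ketbra (commitState l true θ)) c c' =
      if c = c' then (((2 : ℂ) ^ n)⁻¹) ^ l else 0 := by
  simp only [traceRight_commitState, psi, if_true, sum_psi1_mul_star]
  split_ifs with hc
  · simp [hc]
  · obtain ⟨i, hi⟩ := Function.ne_iff.1 hc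
    exact Finset.prod_eq_zero (Finset.mem_univ i) (by simp [hi])

/-! ### Collisions among random strings -/

theorem card_pre_fiber {l n : ℕ} (h : l ≤ n) (a : Qubits l) :
    (Finset.univ.filter fun y : Qubits n => pre h y = a).card = 2 ^ (n - l) := by
  obtain ⟨m, rfl⟩ := Nat.exists_eq_add_of_le h
  have : (Finset.univ.filter fun y : Qubits (l + m) => pre h y = a) =
      Fintype.piFinset fun i : Fin (l + m) =>
        Fin.addCases (motive := fun _ => Finset Bool) (fun j => {a j})
          (fun _ => Finset.univ) i := by
    ext y
    simp only [Finset.mem_filter, Finset.mem_univ, true_and, Fintype.mem_piFinset]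
    constructor
    · rintro rfl i
      refine Fin.addCases (fun j => ?_) (fun j => ?_) i
      · rw [Fin.addCases_left]
        exact Finset.mem_singleton_self _
      · simp
    · intro hy
      funext j
      have := hy (Fin.castAdd m j)
      rw [Fin.addCases_left, Finset.mem_singleton] at this
      exact this
  rw [this, Fintype.card_piFinset, Fin.prod_univ_add]
  simp

/-- The joint law of two coordinates of an independent family is the product of their marginals. -/
theorem sum_pi_prod_mul {ι X : Type} [Fintype ι] [DecidableEq ι] [Fintype X] [DecidableEq X]
    (p : ι → X → ℝ) (hp : ∀ i, ∑ x, p i x = 1) {i j : ι} (hij : i ≠ j) (F : X → X → ℝ) :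
    ∑ z : ι → X, (∏ k, p k (z k)) * F (z i) (z j) = ∑ x, ∑ y, p i x * p j y * F x y := by
  -- The constraints `z i = x` and `z j = y` are written as a factor per coordinate, so that the sum
  -- over `z` becomes a product of sums.
  have h1 (z : ι → X) : (∏ k, p k (z k)) * F (z i) (z j) = ∑ x, ∑ y,
      F x y * ∏ k, p k (z k) * (if (k = i → z k = x) ∧ (k = j → z k = y) then 1 else 0) := by
    have h2 (x y : X) : ∏ k, p k (z k) * (if (k = i → z k = x) ∧ (k = j → z k = y) then 1 else 0)
        = (∏ k, p k (z k)) * (if z i = x then if z j = y then 1 else 0 else 0) := by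
      rw [Finset.prod_mul_distrib]
      congr 1
      split_ifs with hx hy
      · refine Finset.prod_eq_one fun k _ => if_pos ⟨?_, ?_⟩
        · rintro rfl; exact hx
        · rintro rfl; exact hy
      · exact Finset.prod_eq_zero (Finset.mem_univ j) (by simp [hy])
      · exact Finset.prod_eq_zero (Finset.mem_univ i) (by simp [hx])
    simp only [h2]
    simp [mul_comm]
  simp_rw [h1]
  rw [Finset.sum_comm]
  refine Finset.sum_congr rfl fun x _ => ?_
  rw [Finset.sum_comm]
  refine Finset.sum_congr rfl fun y _ => ?_
  rw [← Finset.mul_sum]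
  have h3 := Finset.prod_univ_sum (fun _ : ι => (Finset.univ : Finset X)) (fun k v =>
    p k v * (if (k = i → v = x) ∧ (k = j → v = y) then 1 else 0))
  rw [Fintype.piFinset_univ] at h3
  rw [← h3, mul_comm]
  congr 1
  rw [← Finset.prod_subset (Finset.subset_univ {i, j}), Finset.prod_pair hij]
  · simp [hij, hij.symm]
  · intro k _ hk
    simp only [Finset.mem_insert, Finset.mem_singleton, not_or] at hk
    simp [hk.1, hk.2, hp]

/-- The union bound for collisions of independent samples. -/
theorem sum_not_injective_le {ι X Y : Type} [Fintype ι] [DecidableEq ι] [Fintype X] [DecidableEq X]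
    [DecidableEq Y] (f : X → Y) (p : ι → X → ℝ) (hp0 : ∀ i x, 0 ≤ p i x)
    (hp : ∀ i, ∑ x, p i x = 1) [DecidablePred fun z : ι → X => Function.Injective (f ∘ z)] :
    ∑ z : ι → X, (if Function.Injective (f ∘ z) then 0 else ∏ k, p k (z k)) ≤
      ∑ i, ∑ j, if i = j then 0 else
        ∑ x, ∑ y, p i x * p j y * (if f x = f y then 1 else 0) := by
  have h1 (i j : ι) : (if i = j then 0 else
        ∑ x, ∑ y, p i x * p j y * (if f x = f y then 1 else 0)) =
      ∑ z : ι → X, (∏ k, p k (z k)) *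
        (if i = j then 0 else if f (z i) = f (z j) then 1 else 0) := by
    split_ifs with hij
    · simp
    · exact (sum_pi_prod_mul p hp hij fun x y => if f x = f y then 1 else 0).symm
  simp_rw [h1]
  have h2 : ∀ i, ∑ j, ∑ z : ι → X, (∏ k, p k (z k)) *
      (if i = j then 0 else if f (z i) = f (z j) then 1 else 0) = ∑ z : ι → X, ∑ j,
        (∏ k, p k (z k)) * (if i = j then 0 else if f (z i) = f (z j) then 1 else 0) :=
    fun i => Finset.sum_comm
  simp_rw [h2]
  rw [Finset.sum_comm]
  refine Finset.sum_le_sum fun z _ => ?_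
  have hpos : 0 ≤ ∏ k, p k (z k) := Finset.prod_nonneg fun k _ => hp0 k _
  have hterm (i j : ι) : 0 ≤ (∏ k, p k (z k)) *
      (if i = j then 0 else if f (z i) = f (z j) then 1 else 0) := by
    split_ifs <;> simp [hpos]
  split_ifs with hz
  · exact Finset.sum_nonneg fun i _ => Finset.sum_nonneg fun j _ => hterm i j
  · simp only [Function.Injective, not_forall] at hz
    obtain ⟨i, j, hf, hij⟩ := hz
    refine le_trans ?_ (Finset.single_le_sum (fun i _ => Finset.sum_nonneg fun j _ => hterm i j)
      (Finset.mem_univ i))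
    refine le_trans ?_ (Finset.single_le_sum (fun j _ => hterm i j) (Finset.mem_univ j))
    have : f (z i) = f (z j) := hf
    simp [hij, this]

theorem integral_collision_le {l n : ℕ} (h : l ≤ n) :
    ∑ x : Qubits n, ∑ y, moment x y * (if pre h x = pre h y then 1 else 0) ≤ 2 / 2 ^ l := by
  -- For `n = 0` there are no two distinct strings to define the off-diagonal moment; the total mass
  -- 1 is below 2 anyway.
  rcases Nat.eq_zero_or_pos n with rfl | hn
  · obtain rfl : l = 0 := by omega
    have : ∑ x : Qubits 0, ∑ y, moment x y * (if pre h x = pre h y then 1 else 0) =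
        ∑ x : Qubits 0, ∑ y, moment x y :=
      Finset.sum_congr rfl fun x _ => Finset.sum_congr rfl fun y _ => by
        simp [Subsingleton.elim x y]
    rw [this, sum_moment]
    norm_num
  · have hxy : (fun _ => false : Qubits n) ≠ fun _ => true := by
      intro hc
      simpa using congrFun hc ⟨0, hn⟩
    obtain ⟨b, hb⟩ : ∃ b, b = moment (fun _ => false : Qubits n) fun _ => true := ⟨_, rfl⟩
    have hb0 : 0 ≤ b := hb ▸ moment_nonneg _ _
    -- With `N = 2^n`, normalization reads `N (N + 1) b = 1`, so the collision probability is
    -- `(2^(n-l) + 1)/(2^n + 1)`.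
    have hm (x y : Qubits n) : moment x y = b + if x = y then b else 0 := by
      split_ifs with hxy'
      · subst hxy'
        have : Nontrivial (Qubits n) := ⟨_, _, hxy⟩
        obtain ⟨y, hy⟩ := exists_ne x
        rw [moment_self hy.symm, moment_eq_of_ne hy.symm hxy, hb]
        ring
      · rw [moment_eq_of_ne hxy' hxy, hb, add_zero]
    have hs := sum_moment (n := n)
    simp only [hm, Finset.sum_add_distrib, Finset.sum_const, Finset.sum_ite_eq, Finset.mem_univ,
      if_true, Finset.card_univ, Fintype.card_fun, Fintype.card_bool, Fintype.card_fin,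
      nsmul_eq_mul] at hs
    have hl : ∑ x : Qubits n, ∑ y, moment x y * (if pre h x = pre h y then 1 else 0) =
        2 ^ n * ((2 ^ (n - l) + 1) * b) := by
      have (x : Qubits n) : ∑ y, moment x y * (if pre h x = pre h y then 1 else 0) =
          (2 ^ (n - l) + 1) * b := by
        have hf := card_pre_fiber h (pre h x)
        simp_rw [@eq_comm _ (pre h x)]
        simp only [hm, mul_ite, mul_one, mul_zero]
        rw [← Finset.sum_filter, Finset.sum_add_distrib, Finset.sum_const, hf,
          Finset.sum_ite_eq, if_pos (by simp)]
        simp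
        ring
      rw [Finset.sum_congr rfl fun x _ => this x]
      simp
    rw [hl]
    have hN : (2 : ℝ) ^ n = 2 ^ (n - l) * 2 ^ l := by rw [← pow_add, Nat.sub_add_cancel h]
    have h1 : (1 : ℝ) ≤ 2 ^ (n - l) := one_le_pow₀ (by norm_num)
    have h2 : (1 : ℝ) ≤ 2 ^ l := one_le_pow₀ (by norm_num)
    have hl0 : (0 : ℝ) < 2 ^ l := by positivity
    rw [le_div_iff₀ hl0]
    push_cast at hs
    have hK : (0 : ℝ) ≤ 2 ^ n * b := by positivity
    have : 2 ^ n * ((2 ^ (n - l) + 1) * b) * 2 ^ l = 2 ^ n * b * (2 ^ n + 2 ^ l) := by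
      rw [hN]; ring
    have hle : (2 : ℝ) ^ l ≤ 2 ^ n := pow_le_pow_right₀ (by norm_num) h
    nlinarith [mul_le_mul_of_nonneg_left hle hK]

/-! ### Distinguishing probabilities of channels -/

section Channel

variable {X Y : Type} [Fintype X] [DecidableEq X] [Fintype Y]

theorem Channel.apply_add (Φ : Channel X Y) (ρ σ : Matrix X X ℂ) :
    Φ.apply (ρ + σ) = Φ.apply ρ + Φ.apply σ := by
  simp [Channel.apply, Matrix.mul_add, Matrix.add_mul, Finset.sum_add_distrib]

theorem Channel.apply_smul (Φ : Channel X Y) (c : ℂ) (ρ : Matrix X X ℂ) :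
    Φ.apply (c • ρ) = c • Φ.apply ρ := by
  simp [Channel.apply, Finset.smul_sum]

theorem Channel.trace_apply (Φ : Channel X Y) (ρ : Matrix X X ℂ) :
    (Φ.apply ρ).trace = ρ.trace := by
  have h (i : Fin Φ.rank) : (Φ.kraus i * ρ * (Φ.kraus i).conjTranspose).trace =
      ((Φ.kraus i).conjTranspose * Φ.kraus i * ρ).trace := by
    rw [Matrix.trace_mul_comm, Matrix.mul_assoc]
  rw [Channel.apply, Matrix.trace_sum]
  simp_rw [h]
  rw [← Matrix.trace_sum, ← Finset.sum_mul, Φ.trace_preserving, Matrix.one_mul]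

open scoped ComplexOrder

theorem Channel.apply_posSemidef (Φ : Channel X Y) {ρ : Matrix X X ℂ} (h : ρ.PosSemidef) :
    (Φ.apply ρ).PosSemidef :=
  Matrix.posSemidef_sum _ fun i _ => h.mul_mul_conjTranspose_same (Φ.kraus i)

theorem Channel.apply_re_nonneg (Φ : Channel X Y) {ρ : Matrix X X ℂ} (h : ρ.PosSemidef) (y : Y) :
    0 ≤ (Φ.apply ρ y y).re :=
  (Complex.le_def.1 (Φ.apply_posSemidef h).diag_nonneg).1

theorem Channel.apply_re_le_trace (Φ : Channel X Y) {ρ : Matrix X X ℂ} (h : ρ.PosSemidef)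
    (y : Y) : (Φ.apply ρ y y).re ≤ ρ.trace.re := by
  rw [← Φ.trace_apply ρ, Matrix.trace, Complex.re_sum]
  exact Finset.single_le_sum (f := fun y => ((Φ.apply ρ).diag y).re)
    (fun z _ => Φ.apply_re_nonneg h z) (Finset.mem_univ y)

/-- Two states that are, on the good basis labels, multiples of one and the same block matrix,
have trace distance controlled by their weights on the bad labels. -/
theorem Channel.distinguish_le {K : Type} [Fintype K] [DecidableEq K] (A : Channel X Y)
    {R S : Matrix X X ℂ} (hR : R.PosSemidef) (hS : S.PosSemidef) (tR : R.trace = 1)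
    (tS : S.trace = 1) (good : X → Prop) [DecidablePred good] (key : X → K) (c d : ℝ)
    (eR : ∀ x x', good x ∨ good x' →
      R x x' = if good x ∧ good x' ∧ key x = key x' then (c : ℂ) else 0)
    (eS : ∀ x x', good x ∨ good x' →
      S x x' = if good x ∧ good x' ∧ key x = key x' then (d : ℂ) else 0)
    {ε : ℝ} (bR : ∑ x, (if good x then 0 else (R x x).re) ≤ ε)
    (bS : ∑ x, (if good x then 0 else (S x x).re) ≤ ε) (y : Y) :
    |(A.apply R y y).re - (A.apply S y y).re| ≤ 2 * ε := by
  -- The common block matrix is a Gram matrix, hence positive. Each state is a multiple of it plus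
  -- its compression to the bad labels.
  let W : Matrix K X ℂ := Matrix.of fun k x => if good x ∧ key x = k then 1 else 0
  let G : Matrix X X ℂ := W.conjTranspose * W
  have hG : G.PosSemidef := Matrix.posSemidef_conjTranspose_mul_self W
  have hGe (x x' : X) : G x x' = if good x ∧ good x' ∧ key x = key x' then 1 else 0 := by
    simp only [G, W, Matrix.mul_apply, Matrix.conjTranspose_apply, Matrix.of_apply,
      apply_ite star, star_one, star_zero]
    by_cases h1 : good x <;> by_cases h2 : good x' <;> simp [h1, h2, eq_comm]
  let D : Matrix X X ℂ := Matrix.diagonal fun x => if good x then 0 else 1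
  have hD : D.conjTranspose = D := by
    simp only [D, Matrix.diagonal_conjTranspose]
    congr 1
    funext x
    simp [apply_ite (starRingEnd ℂ)]
  have key1 (T : Matrix X X ℂ) (hT : T.PosSemidef) (tT : T.trace = 1) (e : ℝ)
      (eT : ∀ x x', good x ∨ good x' →
        T x x' = if good x ∧ good x' ∧ key x = key x' then (e : ℂ) else 0)
      (bT : ∑ x, (if good x then 0 else (T x x).re) ≤ ε) :
      ∃ a b : ℝ, 0 ≤ a ∧ a ≤ b ∧ b ≤ ε ∧ (A.apply T y y).re = e * (A.apply G y y).re + a ∧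
        1 = e * G.trace.re + b := by
    have hB : (D * T * D).PosSemidef := by
      have := hT.mul_mul_conjTranspose_same D
      rwa [hD] at this
    have hT2 : T = (e : ℂ) • G + D * T * D := by
      ext x x'
      simp only [D, Matrix.add_apply, Matrix.smul_apply, hGe, Matrix.diagonal_mul,
        Matrix.mul_diagonal, smul_eq_mul]
      by_cases h : good x ∨ good x'
      · rw [eT x x' h]
        rcases h with h | h <;> simp [h]
      · rw [not_or] at h
        simp [h.1, h.2]
    refine ⟨(A.apply (D * T * D) y y).re, (D * T * D).trace.re, A.apply_re_nonneg hB y,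
      A.apply_re_le_trace hB y, ?_, ?_, ?_⟩
    · refine le_trans (le_of_eq ?_) bT
      rw [Matrix.trace, Complex.re_sum]
      refine Finset.sum_congr rfl fun x _ => ?_
      simp only [D, Matrix.diag_apply, Matrix.diagonal_mul, Matrix.mul_diagonal]
      split_ifs <;> simp
    · conv_lhs => rw [hT2, A.apply_add, A.apply_smul]
      simp
    · have := congrArg Complex.re tT
      rw [hT2, Matrix.trace_add, Matrix.trace_smul] at this
      simpa using this.symm
  obtain ⟨a, b, h1, h2, h3, h4, h5⟩ := key1 R hR tR c eR bR
  obtain ⟨a', b', h1', h2', h3', h4', h5'⟩ := key1 S hS tS d eS bS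
  have hg0 := A.apply_re_nonneg hG y
  have hg1 := A.apply_re_le_trace hG y
  rw [h4, h4', abs_le]
  -- The good parts differ by `(c - d) G`. Both traces being 1, `(c - d) tr G` is the difference of
  -- the bad weights, which lie in `[0, ε]`; the bad parts contribute another `ε`.
  have hle : |(c - d) * (A.apply G y y).re| ≤ |(c - d) * G.trace.re| := by
    rw [abs_mul, abs_mul, abs_of_nonneg hg0, abs_of_nonneg (hg0.trans hg1)]
    gcongr
  have hlt : |(c - d) * G.trace.re| ≤ ε := by
    rw [abs_le]
    constructor <;> linarith
  have := abs_le.1 (hle.trans hlt)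
  constructor <;> linarith

end Channel

/-! ### Averaged states -/

theorem continuous_psi (l : ℕ) {n : ℕ} (b : Bool) (z : Qubits n × Qubits n) :
    Continuous fun θ : PureState n => psi l b θ z := by
  obtain ⟨c, r⟩ := z
  cases b
  · simp only [psi, Bool.false_eq_true, if_false, psi0_apply]
    refine continuous_const.mul (continuous_finsetSum _ fun k _ => ?_)
    split_ifs <;> fun_prop
  · simp only [psi, if_true]
    fun_prop

/-- The joint state of `t` copies of the common Haar state and the register `C` of a commitment. -/
def jointState (l t : ℕ) {n : ℕ} (b : Bool) (θ : PureState n) :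
    Matrix ((Fin t → Qubits n) × Reg l n) ((Fin t → Qubits n) × Reg l n) ℂ :=
  ketbra (copies t θ.amp) ⊗ₖ traceRight (ketbra (commitState l b θ))

theorem jointState_apply {l t n : ℕ} (b : Bool) (θ : PureState n)
    (z z' : (Fin t → Qubits n) × Reg l n) :
    jointState l t b θ z z' = (∏ i, θ.amp (z.1 i) * star (θ.amp (z'.1 i))) *
      traceRight (ketbra (commitState l b θ)) z.2 z'.2 := by
  simp [jointState, Matrix.kroneckerMap_apply, ketbra, copies, Matrix.vecMulVec_apply,
    Finset.prod_mul_distrib]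

theorem continuous_jointState (l t : ℕ) {n : ℕ} (b : Bool)
    (z z' : (Fin t → Qubits n) × Reg l n) :
    Continuous fun θ : PureState n => jointState l t b θ z z' := by
  simp only [jointState_apply, traceRight_commitState]
  refine Continuous.mul (by fun_prop) (continuous_finsetProd _ fun j _ =>
    continuous_finsetSum _ fun r _ => ?_)
  exact (continuous_psi l b _).mul (continuous_psi l b _).star

/-- The Haar average of the joint state. -/
def avgState (l t n : ℕ) (b : Bool) :
    Matrix ((Fin t → Qubits n) × Reg l n) ((Fin t → Qubits n) × Reg l n) ℂ :=
  Matrix.of fun z z' => ∫ θ : PureState n, jointState l t b θ z z' ∂(haar n)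

/-- The output of a channel is a finite linear combination of entries of its input, so it commutes
with the Haar integral. -/
theorem hidingProb_eq {l n t : ℕ} (A : Channel ((Fin t → Qubits n) × Reg l n) Bool) (b : Bool) :
    hidingProb l A b = (A.apply (avgState l t n b) true true).re := by
  have hi (z z') : Integrable (fun θ : PureState n => jointState l t b θ z z') (haar n) :=
    integrable_haar (continuous_jointState l t b z z')
  have h1 : A.apply (avgState l t n b) true true =
      ∫ θ : PureState n, A.apply (jointState l t b θ) true true ∂(haar n) := by
    simp only [Channel.apply, Matrix.sum_apply, Matrix.mul_apply, avgState, Matrix.of_apply]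
    rw [integral_finsetSum _ fun i _ => integrable_finsetSum _ fun z' _ =>
      (integrable_finsetSum _ fun z _ => (hi z z').const_mul _).mul_const _]
    refine Finset.sum_congr rfl fun i _ => ?_
    rw [integral_finsetSum _ fun z' _ =>
      (integrable_finsetSum _ fun z _ => (hi z z').const_mul _).mul_const _]
    refine Finset.sum_congr rfl fun z' _ => ?_
    rw [integral_mul_const, integral_finsetSum _ fun z _ => (hi z z').const_mul _]
    simp_rw [integral_const_mul]
  rw [h1]
  have hint : Integrable (fun θ : PureState n => A.apply (jointState l t b θ) true true)
      (haar n) := by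
    simp only [Channel.apply, Matrix.sum_apply, Matrix.mul_apply]
    exact integrable_finsetSum _ fun i _ => integrable_finsetSum _ fun z' _ =>
      (integrable_finsetSum _ fun z _ => (hi z z').const_mul _).mul_const _
  exact integral_re hint

section PosSemidef

open scoped ComplexOrder

theorem ketbra_posSemidef {X : Type} [Fintype X] (u : X → ℂ) : (ketbra u).PosSemidef :=
  Matrix.posSemidef_vecMulVec_self_star u

theorem traceRight_posSemidef {X Y : Type} [Fintype Y] {ρ : Matrix (X × Y) (X × Y) ℂ}
    (h : ρ.PosSemidef) : (traceRight ρ).PosSemidef := by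
  have : traceRight ρ = ∑ y, ρ.submatrix (fun x => (x, y)) fun x => (x, y) := by
    ext x x'
    simp [traceRight, Matrix.sum_apply]
  rw [this]
  exact Matrix.posSemidef_sum _ fun y _ => h.submatrix _

theorem jointState_posSemidef (l t : ℕ) {n : ℕ} (b : Bool) (θ : PureState n) :
    (jointState l t b θ).PosSemidef :=
  (ketbra_posSemidef _).kronecker (traceRight_posSemidef (ketbra_posSemidef _))

theorem avgState_posSemidef (l t n : ℕ) (b : Bool) : (avgState l t n b).PosSemidef := by
  refine Matrix.PosSemidef.of_dotProduct_mulVec_nonneg ?_ fun x => ?_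
  · ext z z'
    rw [Matrix.conjTranspose_apply, avgState, Matrix.of_apply, Matrix.of_apply, Complex.star_def,
      ← integral_conj]
    refine integral_congr_ae (.of_forall fun θ => ?_)
    exact (jointState_posSemidef l t b θ).1.apply z z'
  · have hi (z z') : Integrable (fun θ : PureState n => jointState l t b θ z z') (haar n) :=
      integrable_haar (continuous_jointState l t b z z')
    have : star x ⬝ᵥ (avgState l t n b).mulVec x = ∫ θ : PureState n,
        star x ⬝ᵥ (jointState l t b θ).mulVec x ∂(haar n) := by
      simp only [dotProduct, Matrix.mulVec, avgState, Matrix.of_apply]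
      rw [integral_finsetSum _ fun z _ =>
        (integrable_finsetSum _ fun z' _ => (hi z z').mul_const _).const_mul _]
      refine Finset.sum_congr rfl fun z _ => ?_
      rw [integral_const_mul, integral_finsetSum _ fun z' _ => (hi z z').mul_const _]
      simp_rw [integral_mul_const]
    rw [this]
    exact integral_nonneg fun θ => (jointState_posSemidef l t b θ).dotProduct_mulVec_nonneg x

end PosSemidef

/-! ### Entries of the averaged states -/

section Moments

variable {ι : Type} [Fintype ι] {n : ℕ}

theorem integral_prod_conj (f g : ι → Qubits n) :
    ∫ θ : PureState n, ∏ i, θ.amp (g i) * star (θ.amp (f i)) ∂(haar n) =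
      star (∫ θ : PureState n, ∏ i, θ.amp (f i) * star (θ.amp (g i)) ∂(haar n)) := by
  rw [Complex.star_def, ← integral_conj]
  refine integral_congr_ae (.of_forall fun θ => ?_)
  simp [mul_comm]

theorem integral_prod_eq_zero_of_mem {f g : ι → Qubits n} {x : Qubits n}
    (hf : x ∈ Set.range f) (hg : x ∉ Set.range g) :
    ∫ θ : PureState n, ∏ i, θ.amp (f i) * star (θ.amp (g i)) ∂(haar n) = 0 := by
  classical
  obtain ⟨i₀, hi₀⟩ := hf
  set a := (Finset.univ.filter fun i => f i = x).card with ha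
  have ha0 : a ≠ 0 := Finset.card_ne_zero_of_mem (by simpa using hi₀)
  -- Since `x` occurs `a` times in `f` and never in `g`, this phase at `x` multiplies the integrand
  -- by `u ^ a = -1`.
  set u : Circle := Circle.exp (Real.pi / a) with hu
  have hua : (u : ℂ) ^ a = -1 := by
    rw [hu, Circle.coe_exp, ← Complex.exp_nat_mul, ← Complex.exp_pi_mul_I]
    congr 1
    push_cast
    field_simp
  have h1 := integral_haar_phase (Function.update 1 x u)
    (f := fun v : Qubits n → ℂ => ∏ i, v (f i) * star (v (g i))) (by fun_prop)
  have h2 (θ : PureState n) : ∏ i, (((Function.update 1 x u : Qubits n → Circle) (f i) : ℂ) *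
      θ.amp (f i)) * star (((Function.update 1 x u : Qubits n → Circle) (g i) : ℂ) *
      θ.amp (g i)) = -∏ i, θ.amp (f i) * star (θ.amp (g i)) := by
    have hgi (i : ι) : (Function.update 1 x u : Qubits n → Circle) (g i) = 1 :=
      Function.update_of_ne (fun h => hg ⟨i, h⟩) _ _
    have hfi : ∏ i, ((Function.update 1 x u : Qubits n → Circle) (f i) : ℂ) = -1 := by
      rw [← hua, ha, ← Finset.prod_const, Finset.prod_filter]
      refine Finset.prod_congr rfl fun i _ => ?_
      rw [Function.update_apply]
      split_ifs <;> simp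
    simp only [hgi, Circle.coe_one, one_mul, mul_assoc]
    rw [Finset.prod_mul_distrib, hfi, neg_one_mul]
  simp only [h2] at h1
  rw [integral_neg] at h1
  linear_combination (-1 / 2 : ℂ) * h1

theorem integral_prod_eq_zero {f g : ι → Qubits n} (h : Set.range f ≠ Set.range g) :
    ∫ θ : PureState n, ∏ i, θ.amp (f i) * star (θ.amp (g i)) ∂(haar n) = 0 := by
  by_cases hs : Set.range f ⊆ Set.range g
  · obtain ⟨x, hx, hx'⟩ := Set.not_subset.1 fun hs' => h (hs.antisymm hs')
    have := integral_prod_eq_zero_of_mem hx hx'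
    rw [integral_prod_conj, this, star_zero]
  · obtain ⟨x, hx, hx'⟩ := Set.not_subset.1 hs
    exact integral_prod_eq_zero_of_mem hx hx'

theorem exists_perm_of_range_eq {X : Type} {f g : ι → X} (hf : Function.Injective f)
    (h : Set.range g = Set.range f) : ∃ σ : Equiv.Perm ι, g = f ∘ σ := by
  have h1 (i : ι) : ∃ j, f j = g i := by
    have : g i ∈ Set.range f := h ▸ Set.mem_range_self i
    exact this
  choose s hs using h1
  have hsurj : Function.Surjective s := fun j => by
    obtain ⟨i, hi⟩ : f j ∈ Set.range g := h ▸ Set.mem_range_self j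
    exact ⟨i, hf (by rw [hs, hi])⟩
  exact ⟨Equiv.ofBijective s (Finite.surjective_iff_bijective.1 hsurj), funext fun i => (hs i).symm⟩

/-- An injective `f` with the same range as `g` makes `g` a reordering of `f`, so the integrand is
`∏ |θ_{f i}|²`. A permutation of all strings carries any injective family to any other. -/
theorem exists_integral_prod_eq (ι : Type) [Fintype ι] (n : ℕ) :
    ∃ c : ℝ, ∀ f g : ι → Qubits n, Function.Injective f → Set.range f = Set.range g →
      ∫ θ : PureState n, ∏ i, θ.amp (f i) * star (θ.amp (g i)) ∂(haar n) = c := by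
  have hdiag (f : ι → Qubits n) :
      ∫ θ : PureState n, ∏ i, θ.amp (f i) * star (θ.amp (f i)) ∂(haar n) =
        ((∫ θ : PureState n, ∏ i, ‖θ.amp (f i)‖ ^ 2 ∂(haar n) : ℝ) : ℂ) := by
    rw [← integral_complex_ofReal]
    simp [Complex.mul_conj']
  have hperm (f g : ι → Qubits n) (hf : Function.Injective f) (h : Set.range f = Set.range g) :
      ∫ θ : PureState n, ∏ i, θ.amp (f i) * star (θ.amp (g i)) ∂(haar n) =
        ∫ θ : PureState n, ∏ i, θ.amp (f i) * star (θ.amp (f i)) ∂(haar n) := by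
    obtain ⟨σ, rfl⟩ := exists_perm_of_range_eq hf h.symm
    refine integral_congr_ae (.of_forall fun θ => ?_)
    simp only [Finset.prod_mul_distrib]
    congr 1
    exact Equiv.prod_comp σ fun i => star (θ.amp (f i))
  by_cases h : ∃ f : ι → Qubits n, Function.Injective f
  · obtain ⟨f, hf⟩ := h
    refine ⟨∫ θ : PureState n, ∏ i, ‖θ.amp (f i)‖ ^ 2 ∂(haar n), fun g g' hg hgg' => ?_⟩
    rw [hperm g g' hg hgg', hdiag]
    obtain ⟨e, he⟩ := Equiv.Perm.exists_extending_pair f g hf hg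
    congr 1
    rw [← integral_haar_perm e (f := fun v : Qubits n → ℂ => ∏ i, ‖v (f i)‖ ^ 2) (by fun_prop)]
    simp [← he]
  · exact ⟨0, fun g _ hg => (h ⟨g, hg⟩).elim⟩

end Moments

/-! ### Strings with distinct prefixes and the hiding bound -/

section Good

variable {l t n : ℕ}

/-- All strings held by the distinguisher. -/
def allStrings (z : (Fin t → Qubits n) × Reg l n) : Fin t ⊕ Fin l → Qubits n := Sum.elim z.1 z.2

/-- The first `l` bits of the strings are pairwise distinct. -/
def Good (h : l ≤ n) (z : (Fin t → Qubits n) × Reg l n) : Prop :=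
  Function.Injective (pre h ∘ allStrings z)

/-- The unordered strings of the common state and the ordered strings of the commitment. -/
def blockKey (z : (Fin t → Qubits n) × Reg l n) : Finset (Qubits n) × Reg l n :=
  (Finset.univ.image z.1, z.2)

theorem blockKey_eq_iff {z z' : (Fin t → Qubits n) × Reg l n} :
    blockKey z = blockKey z' ↔ Set.range z.1 = Set.range z'.1 ∧ z.2 = z'.2 := by
  simp only [blockKey, Prod.mk.injEq, ← Finset.coe_inj, Finset.coe_image, Finset.coe_univ,
    Set.image_univ]

theorem range_allStrings (z : (Fin t → Qubits n) × Reg l n) :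
    Set.range (allStrings z) = Set.range z.1 ∪ Set.range z.2 := Set.Sum.elim_range _ _

theorem Good.of_range_eq {h : l ≤ n} {z z' : (Fin t → Qubits n) × Reg l n} (hz : Good h z)
    (hr : Set.range (allStrings z') = Set.range (allStrings z)) : Good h z' := by
  obtain ⟨σ, hσ⟩ := exists_perm_of_range_eq hz.of_comp hr
  rw [Good, hσ, ← Function.comp_assoc]
  exact hz.comp σ.injective

/-- Each committed string of `z'` occurs somewhere in `z`. In a good label its prefix reveals the
position, so the committed strings agree, and removing them leaves equal sets of remaining strings.
-/
theorem Good.blockKey_eq {h : l ≤ n} {z z' : (Fin t → Qubits n) × Reg l n} (hz : Good h z)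
    (hz' : Good h z') (hr : Set.range (allStrings z') = Set.range (allStrings z))
    (hp : ∀ j, pre h (z.2 j) = pre h (z'.2 j)) : blockKey z = blockKey z' := by
  have h2 : z.2 = z'.2 := by
    funext j
    obtain ⟨k, hk⟩ : z'.2 j ∈ Set.range (allStrings z) := hr ▸ ⟨Sum.inr j, rfl⟩
    have : k = Sum.inr j := hz (by
      simp only [Function.comp_apply, hk, ← hp j]
      rfl)
    rw [← hk, this]
    rfl
  have key (w w' : (Fin t → Qubits n) × Reg l n) (hw : Good h w)
      (hr : Set.range (allStrings w') = Set.range (allStrings w)) (h2 : w.2 = w'.2) :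
      Set.range w.1 ⊆ Set.range w'.1 := by
    rintro _ ⟨i, rfl⟩
    obtain ⟨k, hk⟩ : w.1 i ∈ Set.range (allStrings w') := hr ▸ ⟨Sum.inl i, rfl⟩
    rcases k with k | k
    · exact ⟨k, hk⟩
    · have : (Sum.inl i : Fin t ⊕ Fin l) = Sum.inr k := hw.of_comp (by
        simp only [allStrings, Sum.elim_inl, Sum.elim_inr, h2] at hk ⊢
        exact hk.symm)
      cases this
  exact blockKey_eq_iff.2 ⟨(key z z' hz hr h2).antisymm (key z' z hz' hr.symm h2.symm), h2⟩

theorem avgState_false_apply (h : l ≤ n) (z z' : (Fin t → Qubits n) × Reg l n) :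
    avgState l t n false z z' = if ∀ j, pre h (z.2 j) = pre h (z'.2 j) then
      ∫ θ : PureState n, ∏ i, θ.amp (allStrings z i) * star (θ.amp (allStrings z' i)) ∂(haar n)
      else 0 := by
  simp only [avgState, Matrix.of_apply, jointState_apply, traceRight_commitState_false h]
  split_ifs with hc
  · simp [hc, allStrings, Fintype.prod_sum_type]
  · obtain ⟨j, hj⟩ := not_forall.1 hc
    have (θ : PureState n) : (∏ j, if pre h (z.2 j) = pre h (z'.2 j) then
        θ.amp (z.2 j) * star (θ.amp (z'.2 j)) else 0) = 0 :=
      Finset.prod_eq_zero (Finset.mem_univ j) (by simp [hj])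
    simp only [this, mul_zero, integral_zero]

theorem avgState_true_apply (z z' : (Fin t → Qubits n) × Reg l n) :
    avgState l t n true z z' = if z.2 = z'.2 then
      (∫ θ : PureState n, ∏ i, θ.amp (z.1 i) * star (θ.amp (z'.1 i)) ∂(haar n)) *
        (((2 : ℂ) ^ n)⁻¹) ^ l else 0 := by
  simp only [avgState, Matrix.of_apply, jointState_apply, traceRight_commitState_true]
  split_ifs with hc
  · rw [integral_mul_const]
  · simp

/-- Nonzero entries require equal sets of strings, so a good row never meets a bad column. For bit
0, equal prefixes then force equal block keys; for bit 1, the maximally mixed factor forces the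
committed strings to agree. -/
theorem exists_avgState_eq (h : l ≤ n) (b : Bool) : ∃ c : ℝ,
    ∀ z z' : (Fin t → Qubits n) × Reg l n, Good h z ∨ Good h z' → avgState l t n b z z' =
      open Classical in
      if Good h z ∧ Good h z' ∧ blockKey z = blockKey z' then (c : ℂ) else 0 := by
  have hrange {z z' : (Fin t → Qubits n) × Reg l n} (hk : blockKey z = blockKey z') :
      Set.range (allStrings z) = Set.range (allStrings z') := by
    rw [blockKey_eq_iff] at hk
    rw [range_allStrings, range_allStrings, hk.1, hk.2]
  have hboth {z z' : (Fin t → Qubits n) × Reg l n} (hg : Good h z ∨ Good h z')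
      (hr : Set.range (allStrings z) = Set.range (allStrings z')) : Good h z ∧ Good h z' := by
    rcases hg with hg | hg
    · exact ⟨hg, hg.of_range_eq hr.symm⟩
    · exact ⟨hg.of_range_eq hr, hg⟩
  cases b
  · obtain ⟨c, hc⟩ := exists_integral_prod_eq (Fin t ⊕ Fin l) n
    refine ⟨c, fun z z' hg => ?_⟩
    rw [avgState_false_apply h]
    by_cases hk : blockKey z = blockKey z'
    · have hg' := hboth hg (hrange hk)
      rw [if_pos fun j => by rw [(blockKey_eq_iff.1 hk).2], if_pos ⟨hg'.1, hg'.2, hk⟩,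
        hc _ _ hg'.1.of_comp (hrange hk)]
    · rw [if_neg (c := Good h z ∧ _) fun hh => hk hh.2.2]
      split_ifs with hp
      · refine integral_prod_eq_zero fun hr => ?_
        have hg' := hboth hg hr
        exact hk (hg'.1.blockKey_eq hg'.2 hr.symm hp)
      · rfl
  · obtain ⟨c, hc⟩ := exists_integral_prod_eq (Fin t) n
    refine ⟨c * (((2 : ℝ) ^ n)⁻¹) ^ l, fun z z' hg => ?_⟩
    rw [avgState_true_apply]
    by_cases hk : blockKey z = blockKey z'
    · have hg' := hboth hg (hrange hk)
      have hinj : Function.Injective z.1 := fun i j hij =>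
        Sum.inl_injective (hg'.1.of_comp (show allStrings z (Sum.inl i) = _ from hij))
      rw [if_pos (blockKey_eq_iff.1 hk).2, if_pos ⟨hg'.1, hg'.2, hk⟩,
        hc _ _ hinj (blockKey_eq_iff.1 hk).1]
      push_cast
      rfl
    · rw [if_neg (c := Good h z ∧ _) fun hh => hk hh.2.2]
      split_ifs with hp
      · rw [integral_prod_eq_zero fun hr => hk (blockKey_eq_iff.2 ⟨hr, hp⟩), zero_mul]
      · rfl

/-- The distribution of the `i`-th string, given the common Haar state. -/
def weight (l t : ℕ) {n : ℕ} (b : Bool) (θ : PureState n) (i : Fin t ⊕ Fin l) (x : Qubits n) : ℝ :=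
  if b && i.isRight then ((2 : ℝ) ^ n)⁻¹ else ‖θ.amp x‖ ^ 2

theorem weight_nonneg (b : Bool) (θ : PureState n) (i : Fin t ⊕ Fin l) (x : Qubits n) :
    0 ≤ weight l t b θ i x := by
  unfold weight
  split_ifs <;> positivity

theorem sum_weight (b : Bool) (θ : PureState n) (i : Fin t ⊕ Fin l) :
    ∑ x, weight l t b θ i x = 1 := by
  unfold weight
  split_ifs
  · simp
  · exact sum_norm_amp_sq θ

@[fun_prop]
theorem continuous_weight (b : Bool) (i : Fin t ⊕ Fin l) (x : Qubits n) :
    Continuous fun θ : PureState n => weight l t b θ i x := by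
  unfold weight
  split_ifs <;> fun_prop

/-- Measured in the computational basis, the strings are independent given `θ`. This turns the
weight of bad labels into a classical collision probability. -/
theorem avgState_diag (h : l ≤ n) (b : Bool) (z : (Fin t → Qubits n) × Reg l n) :
    avgState l t n b z z =
      ((∫ θ : PureState n, ∏ i, weight l t b θ i (allStrings z i) ∂(haar n) : ℝ) : ℂ) := by
  rw [← integral_complex_ofReal]
  cases b
  · rw [avgState_false_apply h, if_pos fun j => rfl]
    simp [weight, Complex.mul_conj']
  · rw [avgState_true_apply, if_pos rfl, ← integral_mul_const]
    simp [weight, Complex.mul_conj', allStrings, Fintype.prod_sum_type]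

theorem trace_avgState (h : l ≤ n) (b : Bool) : (avgState l t n b).trace = 1 := by
  rw [Matrix.trace]
  simp only [Matrix.diag_apply, avgState_diag h]
  rw [← Complex.ofReal_sum, ← integral_finsetSum _ fun z _ => integrable_haar (by fun_prop)]
  have (θ : PureState n) : ∑ z : (Fin t → Qubits n) × Reg l n,
      ∏ i, weight l t b θ i (allStrings z i) = 1 := by
    rw [← (Equiv.sumArrowEquivProdArrow (Fin t) (Fin l) (Qubits n)).sum_comp]
    have h3 := Finset.prod_univ_sum (fun _ : Fin t ⊕ Fin l => (Finset.univ : Finset (Qubits n)))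
      (fun i x => weight l t b θ i x)
    rw [Fintype.piFinset_univ] at h3
    simp only [sum_weight, Finset.prod_const_one] at h3
    rw [h3]
    refine Finset.sum_congr rfl fun f _ => Finset.prod_congr rfl fun i _ => ?_
    cases i <;> rfl
  simp only [this, integral_const, probReal_univ, one_smul, Complex.ofReal_one]

theorem integral_collision_weight_le (h : l ≤ n) (b : Bool) (i j : Fin t ⊕ Fin l) :
    ∫ θ : PureState n, ∑ x, ∑ y, weight l t b θ i x * weight l t b θ j y *
      (if pre h x = pre h y then 1 else 0) ∂(haar n) ≤ 2 / 2 ^ l := by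
  have hunif : ((2 : ℝ) ^ n)⁻¹ * 2 ^ (n - l) ≤ 2 / 2 ^ l := by
    have : (2 : ℝ) ^ n = 2 ^ (n - l) * 2 ^ l := by rw [← pow_add, Nat.sub_add_cancel h]
    rw [this, mul_inv, mul_right_comm, inv_mul_cancel₀ (by positivity), one_mul, inv_eq_one_div]
    gcongr
    norm_num
  have hcard (x : Qubits n) : ∑ y : Qubits n, (if pre h x = pre h y then (1 : ℝ) else 0) =
      2 ^ (n - l) := by
    have := card_pre_fiber h (pre h x)
    simp_rw [@eq_comm _ (pre h x)]
    rw [← Finset.sum_filter, Finset.sum_const, this]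
    simp
  have hcard' (y : Qubits n) : ∑ x : Qubits n, (if pre h x = pre h y then (1 : ℝ) else 0) =
      2 ^ (n - l) := by
    simp_rw [@eq_comm _ _ (pre h y)]
    exact hcard y
  -- If one of the two strings is uniform, the collision probability is exactly `2^(n-l)/2^n`
  -- whatever the other distribution; otherwise both are measured from `θ` and the second moments
  -- enter.
  by_cases hj : (b && j.isRight) = true
  · have (θ : PureState n) : ∑ x, ∑ y, weight l t b θ i x * weight l t b θ j y *
        (if pre h x = pre h y then 1 else 0) = ((2 : ℝ) ^ n)⁻¹ * 2 ^ (n - l) := by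
      have hw (y : Qubits n) : weight l t b θ j y = ((2 : ℝ) ^ n)⁻¹ := by
        rw [weight, if_pos hj]
      simp only [hw]
      simp_rw [← Finset.mul_sum, hcard, ← Finset.sum_mul, sum_weight]
      ring
    simpa only [this, integral_const, probReal_univ, one_smul] using hunif
  by_cases hi : (b && i.isRight) = true
  · have (θ : PureState n) : ∑ x, ∑ y, weight l t b θ i x * weight l t b θ j y *
        (if pre h x = pre h y then 1 else 0) = ((2 : ℝ) ^ n)⁻¹ * 2 ^ (n - l) := by
      have hw (y : Qubits n) : weight l t b θ i y = ((2 : ℝ) ^ n)⁻¹ := by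
        rw [weight, if_pos hi]
      simp only [hw]
      rw [Finset.sum_comm]
      simp_rw [← Finset.mul_sum, hcard', ← Finset.sum_mul, ← Finset.mul_sum, sum_weight]
      ring
    simpa only [this, integral_const, probReal_univ, one_smul] using hunif
  · refine le_trans (le_of_eq ?_) (integral_collision_le h)
    have hw (θ : PureState n) (x : Qubits n) : weight l t b θ i x = ‖θ.amp x‖ ^ 2 := by
      rw [weight, if_neg hi]
    have hw' (θ : PureState n) (x : Qubits n) : weight l t b θ j x = ‖θ.amp x‖ ^ 2 := by
      rw [weight, if_neg hj]
    simp only [hw, hw']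
    rw [integral_finsetSum _ fun x _ => integrable_haar (by fun_prop)]
    refine Finset.sum_congr rfl fun x _ => ?_
    rw [integral_finsetSum _ fun x _ => integrable_haar (by fun_prop)]
    refine Finset.sum_congr rfl fun y _ => ?_
    rw [integral_mul_const, moment]

theorem sum_not_good_le (h : l ≤ n) (b : Bool) [DecidablePred (Good (t := t) h)] :
    ∑ z : (Fin t → Qubits n) × Reg l n, (if Good h z then 0 else (avgState l t n b z z).re) ≤
      ((t : ℝ) + l) ^ 2 * (2 / 2 ^ l) := by
  classical
  have h1 (z : (Fin t → Qubits n) × Reg l n) :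
      (if Good h z then 0 else (avgState l t n b z z).re) = ∫ θ : PureState n,
        (if Good h z then 0 else ∏ i, weight l t b θ i (allStrings z i)) ∂(haar n) := by
    rw [avgState_diag h, Complex.ofReal_re]
    split_ifs <;> simp
  have hint (z : (Fin t → Qubits n) × Reg l n) : Integrable (fun θ : PureState n =>
      if Good h z then 0 else ∏ i, weight l t b θ i (allStrings z i)) (haar n) := by
    split_ifs
    · simp
    · exact integrable_haar (by fun_prop)
  have hint2 (i j : Fin t ⊕ Fin l) : Integrable (fun θ : PureState n => if i = j then 0 else
      ∑ x, ∑ y, weight l t b θ i x * weight l t b θ j y *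
        (if pre h x = pre h y then 1 else 0)) (haar n) := by
    split_ifs
    · simp
    · exact integrable_haar (by fun_prop)
  simp_rw [h1]
  rw [← integral_finsetSum _ fun z _ => hint z]
  calc _ ≤ ∫ θ : PureState n, ∑ i : Fin t ⊕ Fin l, ∑ j, (if i = j then 0 else
        ∑ x, ∑ y, weight l t b θ i x * weight l t b θ j y *
          (if pre h x = pre h y then 1 else 0)) ∂(haar n) := by
        refine integral_mono (integrable_finsetSum _ fun z _ => hint z)
          (integrable_finsetSum _ fun i _ => integrable_finsetSum _ fun j _ => hint2 i j)
          fun θ => ?_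
        refine le_trans (le_of_eq ?_) (sum_not_injective_le (pre h) (weight l t b θ)
          (weight_nonneg b θ) (sum_weight b θ))
        rw [← (Equiv.sumArrowEquivProdArrow (Fin t) (Fin l) (Qubits n)).sum_comp]
        refine Finset.sum_congr rfl fun f _ => ?_
        have hf : allStrings (Equiv.sumArrowEquivProdArrow (Fin t) (Fin l) (Qubits n) f) = f := by
          funext i
          cases i <;> rfl
        simp only [Good, hf]
    _ = ∑ i : Fin t ⊕ Fin l, ∑ j, ∫ θ : PureState n, (if i = j then 0 else
        ∑ x, ∑ y, weight l t b θ i x * weight l t b θ j y *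
          (if pre h x = pre h y then 1 else 0)) ∂(haar n) := by
        rw [integral_finsetSum _ fun i _ => integrable_finsetSum _ fun j _ => hint2 i j]
        exact Finset.sum_congr rfl fun i _ => integral_finsetSum _ fun j _ => hint2 i j
    _ ≤ ∑ i : Fin t ⊕ Fin l, ∑ j : Fin t ⊕ Fin l, (2 / 2 ^ l : ℝ) := by
        refine Finset.sum_le_sum fun i _ => Finset.sum_le_sum fun j _ => ?_
        split_ifs
        · simp only [integral_zero]
          positivity
        · exact integral_collision_weight_le h b i j
    _ = ((t : ℝ) + l) ^ 2 * (2 / 2 ^ l) := by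
        simp
        ring

/-- The hiding advantage with `t` copies of the common Haar state. -/
theorem abs_hidingProb_sub_le (h : l ≤ n) (A : Channel ((Fin t → Qubits n) × Reg l n) Bool) :
    |hidingProb l A false - hidingProb l A true| ≤ 4 * ((t : ℝ) + l) ^ 2 / 2 ^ l := by
  classical
  obtain ⟨c, hc⟩ := exists_avgState_eq (t := t) h false
  obtain ⟨d, hd⟩ := exists_avgState_eq (t := t) h true
  rw [hidingProb_eq, hidingProb_eq]
  refine (A.distinguish_le (avgState_posSemidef l t n false) (avgState_posSemidef l t n true)
    (trace_avgState h false) (trace_avgState h true) (Good h) blockKey c d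
    (fun z z' hg => (hc z z' hg).trans (by congr)) (fun z z' hg => (hd z z' hg).trans (by congr))
    (sum_not_good_le h false) (sum_not_good_le h true) true).trans (le_of_eq ?_)
  ring

end Good

/-! ### Negligible bounds and asymptotic hiding -/

theorem tendsto_pow_mul_geometric (k : ℕ) {r : ℝ} (hr0 : 0 ≤ r) (hr : r < 1) :
    Filter.Tendsto (fun l : ℕ => (l : ℝ) ^ k * r ^ l) Filter.atTop (nhds 0) :=
  tendsto_pow_const_mul_const_pow_of_abs_lt_one k (by rwa [abs_of_nonneg hr0])

theorem negligible_pow {r : ℝ} (hr0 : 0 ≤ r) (hr : r < 1) : Negligible fun l => r ^ l :=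
  fun k => tendsto_pow_mul_geometric k hr0 hr

theorem polyCopyStatisticallyHiding {n : ℕ → ℕ} (hn : ∀ l, l ≤ n l) :
    PolyCopyStatisticallyHiding n := by
  rintro t ⟨q, hq⟩ A
  have hneg : Negligible fun l => (4 * (q.map (Nat.castRingHom ℝ) + Polynomial.X) ^ 2).eval
      (l : ℝ) * (1 / 2 : ℝ) ^ l :=
    Asymptotics.SuperpolynomialDecay.polynomial_mul
      (negligible_pow (r := 1 / 2) (by norm_num) (by norm_num)) _
  refine ⟨_, hneg, fun l => ?_⟩
  refine (abs_hidingProb_sub_le (hn l) (A l)).trans ?_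
  have hqt : (t l : ℝ) ≤ (q.map (Nat.castRingHom ℝ)).eval (l : ℝ) := by
    have : (q.map (Nat.castRingHom ℝ)).eval (l : ℝ) = ((q.eval l : ℕ) : ℝ) := by
      rw [Polynomial.eval_natCast_map]
      simp
    rw [this]
    exact_mod_cast hq l
  simp only [Polynomial.eval_mul, Polynomial.eval_pow, Polynomial.eval_add, Polynomial.eval_X,
    Polynomial.eval_ofNat]
  rw [div_eq_mul_inv, one_div, inv_pow]
  gcongr

/-! ### The acceptance probability of the SWAP tests -/

/-- The projector onto the symmetric subspace of two registers. -/
def symProj (Y : Type) [DecidableEq Y] : Matrix (Y × Y) (Y × Y) ℂ :=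
  Matrix.of fun a b => 2⁻¹ * ((if a = b then 1 else 0) + if a = b.swap then 1 else 0)

/-- Conjugating the controlled swap by Hadamards averages the identity and the swap on the accepting
branch. -/
theorem swapTest_apply {Y : Type} [Fintype Y] [DecidableEq Y] (a b : Y × Y) :
    swapTest Y (false, a) (false, b) = symProj Y a b := by
  have hs : (((1 / √2 : ℝ) : ℂ)) * ((1 / √2 : ℝ) : ℂ) = 2⁻¹ := by
    rw [← Complex.ofReal_mul, div_mul_div_comm, one_mul, Real.mul_self_sqrt (by norm_num)]
    simp
  simp only [swapTest, Matrix.mul_apply, Matrix.kroneckerMap_apply, Fintype.sum_prod_type,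
    Fintype.sum_bool, hadamard, Matrix.of_apply, controlledSwap, Matrix.one_apply, symProj,
    Prod.mk.injEq]
  obtain ⟨x, y⟩ := b
  simp only [one_div, Complex.ofReal_inv] at hs
  simp [ite_and, hs, Finset.sum_ite_irrel]
  split_ifs <;> norm_num

/-- Idempotence and self-adjointness of the symmetric projector, in the form that merges the two
copies of the test circuit surrounding the state. -/
theorem sum_symProj_mul {Y : Type} [Fintype Y] [DecidableEq Y] (a b : Y × Y) :
    ∑ v, symProj Y v a * star (symProj Y v b) = symProj Y b a := by
  have hsw : ∀ x y : Y × Y, x.swap = y.swap ↔ x = y := fun x y => Prod.swap_injective.eq_iff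
  have hsw' : ∀ x y : Y × Y, x.swap = y ↔ x = y.swap := fun x y => by
    rw [← hsw x, Prod.swap_swap]
  simp only [symProj, Matrix.of_apply, star_mul', star_add, apply_ite star, star_one, star_zero]
  have h2 : star (2⁻¹ : ℂ) = 2⁻¹ := by simp
  simp only [h2]
  have h (v : Y × Y) : 2⁻¹ * ((if v = a then 1 else 0) + if v = a.swap then 1 else 0) *
      (2⁻¹ * ((if v = b then 1 else 0) + if v = b.swap then 1 else 0)) =
      4⁻¹ * ((if v = a then ((if v = b then 1 else 0) + if v = b.swap then 1 else 0) else 0) +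
      if v = a.swap then ((if v = b then 1 else 0) + if v = b.swap then 1 else 0)
        else (0 : ℂ)) := by
    split_ifs <;> norm_num
  simp_rw [h]
  rw [← Finset.mul_sum, Finset.sum_add_distrib]
  simp only [Finset.sum_ite_eq', Finset.mem_univ, if_true, hsw, hsw']
  simp only [@eq_comm _ a, hsw']
  ring

theorem sum_ite_false {κ V : Type} [Fintype κ] [DecidableEq κ] [Fintype V]
    [DecidablePred fun s : κ → Bool × V => ∀ i, (s i).1 = false] (F : (κ → Bool × V) → ℂ) :
    ∑ s : κ → Bool × V, (if ∀ i, (s i).1 = false then F s else 0) =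
      ∑ v : κ → V, F fun i => (false, v i) := by
  symm
  refine Fintype.sum_of_injective (fun v i => (false, v i)) ?_ _ _ ?_ ?_
  · intro v w h
    funext i
    exact (Prod.mk.inj (congrFun h i)).2
  · intro s hs
    refine if_neg fun h => hs ⟨fun i => (s i).2, ?_⟩
    funext i
    exact Prod.ext (h i).symm rfl
  · simp

theorem sum_prod_pi {κ V : Type} [Fintype κ] [DecidableEq κ] [Fintype V] (f : κ → V → ℂ) :
    ∑ v : κ → V, ∏ i, f i (v i) = ∏ i, ∑ v, f i v := by
  rw [Finset.prod_univ_sum, Fintype.piFinset_univ]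

/-- The SWAP test against a fixed state. -/
theorem sum_symProj_state {Y : Type} [Fintype Y] [DecidableEq Y] (ψ : Y → ℂ)
    (hψ : ∑ y, ψ y * star (ψ y) = 1) (g g' : Y) :
    ∑ h, ∑ h', ψ h * star (ψ h') * symProj Y (g', h') (g, h) =
      2⁻¹ * ((if g = g' then 1 else 0) + ψ g' * star (ψ g)) := by
  simp only [symProj, Matrix.of_apply, Prod.swap_prod_mk, Prod.mk.injEq]
  have h1 : ∀ h h', ψ h * star (ψ h') * (2⁻¹ * ((if g' = g ∧ h' = h then 1 else 0) +
      if g' = h ∧ h' = g then 1 else 0)) = 2⁻¹ * ((if h' = h then if g = g' then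
        ψ h * star (ψ h') else 0 else 0) +
        if h' = g then if h = g' then ψ h * star (ψ h') else 0 else 0) := by
    intro h h'
    simp only [ite_and, @eq_comm _ g']
    split_ifs <;> ring
  simp only [h1, ← Finset.mul_sum, Finset.sum_add_distrib, Finset.sum_ite_eq', Finset.mem_univ,
    if_true]
  congr 2
  split_ifs with hg
  · exact hψ
  · exact Finset.sum_const_zero

theorem psi_norm {l n : ℕ} (h : l ≤ n) (b : Bool) (θ : PureState n) :
    ∑ z, psi l b θ z * star (psi l b θ z) = 1 := by
  rw [Fintype.sum_prod_type]
  cases b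
  · simp only [psi, Bool.false_eq_true, if_false, sum_psi0_mul_star h, if_true]
    have := sum_norm_amp_sq θ
    simp only [Complex.star_def, Complex.mul_conj']
    exact_mod_cast this
  · simp only [psi, if_true, sum_psi1_mul_star]
    simp

/-- Basis labels of one pair of registers `Cᵢ`, `Rᵢ`. -/
abbrev Pair (n : ℕ) : Type := Qubits n × Qubits n

/-- The acceptance probability as a quadratic form in the revealed state. -/
theorem acceptProb_eq {l n : ℕ} (h : l ≤ n) (b : Bool) (θ : PureState n)
    (ρ : Matrix (Reg l n × Reg l n) (Reg l n × Reg l n) ℂ) :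
    acceptProb l b θ ρ = (∑ z, ∑ z', ρ z z' * ∏ i, (2⁻¹ *
      ((if (z.1 i, z.2 i) = (z'.1 i, z'.2 i) then 1 else 0) +
        psi l b θ (z'.1 i, z'.2 i) * star (psi l b θ (z.1 i, z.2 i))))).re := by
  let W := opPow l (swapTest (Pair n))
  let unz : (Fin l → Pair n) → Reg l n × Reg l n := fun g => (fun i => (g i).1, fun i => (g i).2)
  let Ψ : (Fin l → Pair n) → ℂ := fun h => ∏ i, psi l b θ (h i)
  have hT (s s' : TestReg l n) : testInput l b θ ρ s s' =
      if ∀ i, (s i).1 = false then if ∀ i, (s' i).1 = false then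
        ρ (unz fun i => (s i).2.1) (unz fun i => (s' i).2.1) *
          (Ψ (fun i => (s i).2.2) * star (Ψ fun i => (s' i).2.2)) else 0 else 0 := by
    have hk (s : TestReg l n) : copies l (ket false) (fun i => (s i).1) =
        if ∀ i, (s i).1 = false then 1 else 0 := by
      simp only [copies, ket, Pi.single_apply]
      rw [Finset.prod_ite_zero]
      simp
    simp only [testInput, Matrix.of_apply, ketbra, Matrix.vecMulVec_apply, Pi.star_apply, hk,
      commitState]
    split_ifs <;> simp [unz, Ψ]
  have hW (v a : Fin l → Pair n × Pair n) : W (fun i => (false, v i)) (fun i => (false, a i)) =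
      ∏ i, symProj (Pair n) (v i) (a i) := by
    simp only [W, opPow, Matrix.of_apply, swapTest_apply]
  rw [acceptProb]
  congr 1
  calc _ = ∑ v : Fin l → Pair n × Pair n, ∑ a' : Fin l → Pair n × Pair n,
        ∑ a : Fin l → Pair n × Pair n, (∏ i, symProj (Pair n) (v i) (a i)) *
          (ρ (unz fun i => (a i).1) (unz fun i => (a' i).1) *
          (Ψ (fun i => (a i).2) * star (Ψ fun i => (a' i).2))) *
            star (∏ i, symProj (Pair n) (v i) (a' i)) := by
        refine (sum_ite_false fun s => (W * testInput l b θ ρ * W.conjTranspose) s s).trans ?_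
        refine Finset.sum_congr rfl fun v _ => ?_
        rw [Matrix.mul_apply]
        have h1 (s' : TestReg l n) : (W * testInput l b θ ρ) (fun i => (false, v i)) s' *
            W.conjTranspose s' (fun i => (false, v i)) = if ∀ i, (s' i).1 = false then
              (∑ a : Fin l → Pair n × Pair n, W (fun i => (false, v i)) (fun i => (false, a i)) *
                (ρ (unz fun i => (a i).1) (unz fun i => (s' i).2.1) *
                  (Ψ (fun i => (a i).2) * star (Ψ fun i => (s' i).2.2)))) *
                  star (W (fun i => (false, v i)) s') else 0 := by
          rw [Matrix.mul_apply, Matrix.conjTranspose_apply]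
          simp only [hT, mul_ite, mul_zero]
          rw [sum_ite_false (fun s : TestReg l n => if ∀ i, (s' i).1 = false then
            W (fun i => (false, v i)) s * (ρ (unz fun i => (s i).2.1) (unz fun i => (s' i).2.1) *
          (Ψ (fun i => (s i).2.2) * star (Ψ fun i => (s' i).2.2))) else 0)]
          split_ifs
          · rfl
          · simp
        rw [Finset.sum_congr rfl fun s' _ => h1 s', sum_ite_false]
        simp only [hW, Finset.sum_mul]
    _ = ∑ a' : Fin l → Pair n × Pair n, ∑ a : Fin l → Pair n × Pair n,
        ρ (unz fun i => (a i).1) (unz fun i => (a' i).1) *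
          ((Ψ (fun i => (a i).2) * star (Ψ fun i => (a' i).2)) *
            ∏ i, symProj (Pair n) (a' i) (a i)) := by
        rw [Finset.sum_comm]
        refine Finset.sum_congr rfl fun a' _ => ?_
        rw [Finset.sum_comm]
        refine Finset.sum_congr rfl fun a _ => ?_
        have h2 : ∏ i, symProj (Pair n) (a' i) (a i) = ∑ v : Fin l → Pair n × Pair n,
            (∏ i, symProj (Pair n) (v i) (a i)) * star (∏ i, symProj (Pair n) (v i) (a' i)) := by
          simp only [← sum_symProj_mul (a _) (a' _), ← sum_prod_pi, star_prod,
            Finset.prod_mul_distrib]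
        rw [h2, Finset.mul_sum, Finset.mul_sum]
        refine Finset.sum_congr rfl fun v _ => ?_
        ring
    _ = ∑ g' : Fin l → Pair n, ∑ g : Fin l → Pair n, ρ (unz g) (unz g') *
        ∑ h : Fin l → Pair n, ∑ h' : Fin l → Pair n, (Ψ h * star (Ψ h')) *
          ∏ i, symProj (Pair n) (g' i, h' i) (g i, h i) := by
        rw [← (Equiv.arrowProdEquivProdArrow (Fin l) (fun _ => Pair n)
          fun _ => Pair n).symm.sum_comp,
          Fintype.sum_prod_type]
        refine Finset.sum_congr rfl fun g' _ => ?_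
        rw [Finset.sum_comm]
        rw [← (Equiv.arrowProdEquivProdArrow (Fin l) (fun _ => Pair n)
          fun _ => Pair n).symm.sum_comp,
          Fintype.sum_prod_type]
        refine Finset.sum_congr rfl fun g _ => ?_
        rw [Finset.mul_sum]
        refine Finset.sum_congr rfl fun h _ => ?_
        rw [Finset.mul_sum]
        rfl
    _ = ∑ g : Fin l → Pair n, ∑ g' : Fin l → Pair n, ρ (unz g) (unz g') * ∏ i, (2⁻¹ *
        ((if g i = g' i then 1 else 0) + psi l b θ (g' i) * star (psi l b θ (g i)))) := by
        rw [Finset.sum_comm]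
        -- Contracting the receiver's own copies of `ψ` leaves the effect `(1 + |ψ⟩⟨ψ|)/2` on each
        -- revealed pair.
        refine Finset.sum_congr rfl fun g _ => Finset.sum_congr rfl fun g' _ => ?_
        congr 1
        simp only [← sum_symProj_state (psi l b θ) (psi_norm h b θ), ← sum_prod_pi,
          Finset.prod_mul_distrib, Ψ, star_prod]
    _ = _ := by
        rw [← (Equiv.arrowProdEquivProdArrow (Fin l) (fun _ => Qubits n)
          fun _ => Qubits n).symm.sum_comp]
        refine Finset.sum_congr rfl fun z _ => ?_
        rw [← (Equiv.arrowProdEquivProdArrow (Fin l) (fun _ => Qubits n)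
          fun _ => Qubits n).symm.sum_comp]
        rfl

/-! ### A bound on the sum of two acceptance probabilities -/

section Hilbert

variable {H : Type*} [NormedAddCommGroup H] [InnerProductSpace ℂ H] {A : Type} [Fintype A]

/-- An operator and its adjoint have the same norm: pair `v` with the combination of the `β a` whose
coefficients are the conjugated inner products. -/
theorem sum_norm_inner_sq_le {β : A → H} {F : ℝ}
    (hβ : ∀ c : A → ℂ, ‖∑ a, c a • β a‖ ^ 2 ≤ (∑ a, ‖c a‖ ^ 2) * F ^ 2) (v : H) :
    ∑ a, ‖inner ℂ v (β a)‖ ^ 2 ≤ (‖v‖ * F) ^ 2 := by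
  set X := ∑ a, ‖inner ℂ v (β a)‖ ^ 2 with hX
  have hX0 : 0 ≤ X := Finset.sum_nonneg fun a _ => by positivity
  have h1 : ((X : ℝ) : ℂ) = inner ℂ v (∑ a, star (inner ℂ v (β a)) • β a) := by
    rw [inner_sum, hX]
    push_cast
    refine Finset.sum_congr rfl fun a _ => ?_
    rw [inner_smul_right, Complex.star_def, mul_comm, Complex.mul_conj']
  have h2 : X ≤ ‖v‖ * ‖∑ a, star (inner ℂ v (β a)) • β a‖ := by
    have := norm_inner_le_norm (𝕜 := ℂ) v (∑ a, star (inner ℂ v (β a)) • β a)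
    rwa [← h1, Complex.norm_real, Real.norm_of_nonneg hX0] at this
  have h3 := hβ fun a => star (inner ℂ v (β a))
  simp only [norm_star] at h3
  rw [← hX] at h3
  have h4 : X ^ 2 ≤ X * (‖v‖ * F) ^ 2 := by
    calc X ^ 2 ≤ (‖v‖ * ‖∑ a, star (inner ℂ v (β a)) • β a‖) ^ 2 := by gcongr
      _ = ‖v‖ ^ 2 * ‖∑ a, star (inner ℂ v (β a)) • β a‖ ^ 2 := by ring
      _ ≤ ‖v‖ ^ 2 * (X * F ^ 2) := by gcongr
      _ = X * (‖v‖ * F) ^ 2 := by ring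
  rcases hX0.eq_or_lt with h | h
  · rw [← h]; positivity
  · nlinarith

/-- Two states whose marginals are far apart cannot both be approached from one state of the
complementary register. -/
theorem sum_sq_le_of_overlap {α β : A → H} {F G : ℝ} (hF : 0 ≤ F) (hG : 0 ≤ G)
    (hα : ∀ c : A → ℂ, ‖∑ a, c a • α a‖ ^ 2 ≤ (∑ a, ‖c a‖ ^ 2) * F ^ 2)
    (hβ : ∀ c : A → ℂ, ‖∑ a, c a • β a‖ ^ 2 ≤ (∑ a, ‖c a‖ ^ 2) * G ^ 2)
    (φ : A × A → ℂ) (hφ : ∑ z, ‖φ z‖ ^ 2 = 1) (P : Finset A) (hP : ∀ a b, b ∉ P → φ (a, b) = 0)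
    {κ s : ℝ} (hκ : Fintype.card A * κ ^ 2 = 1) (hs0 : 0 ≤ s) (hs : P.card * κ ^ 2 = s ^ 2)
    (u : A → H)
    (hu : F ^ 2 + G ^ 2 = ∑ a, (inner ℂ (u a) ((∑ b, φ (a, b) • α b) + (κ : ℂ) • β a)).re) :
    F ^ 2 + G ^ 2 ≤ (1 + s) * ∑ a, ‖u a‖ ^ 2 := by
  classical
  rw [Fintype.sum_prod_type] at hφ
  set v : A → H := fun a => ∑ b, φ (a, b) • α b with hv
  have hv2 : ∑ a, ‖v a‖ ^ 2 ≤ F ^ 2 := by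
    calc ∑ a, ‖v a‖ ^ 2 ≤ ∑ a, (∑ b, ‖φ (a, b)‖ ^ 2) * F ^ 2 :=
          Finset.sum_le_sum fun a _ => hα fun b => φ (a, b)
      _ = F ^ 2 := by rw [← Finset.sum_mul, hφ, one_mul]
  have single {γ : A → H} {K : ℝ} (hK : 0 ≤ K)
      (hγ : ∀ c : A → ℂ, ‖∑ a, c a • γ a‖ ^ 2 ≤ (∑ a, ‖c a‖ ^ 2) * K ^ 2) (a : A) :
      ‖γ a‖ ≤ K := by
    have := hγ (Pi.single a 1)
    refine (sq_le_sq₀ (norm_nonneg _) hK).1 ?_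
    simpa [Pi.single_apply, apply_ite norm, ite_pow] using this
  have hβ2 : ∑ a, ‖(κ : ℂ) • β a‖ ^ 2 ≤ G ^ 2 := by
    calc ∑ a, ‖(κ : ℂ) • β a‖ ^ 2 ≤ ∑ a : A, κ ^ 2 * G ^ 2 := by
          refine Finset.sum_le_sum fun a _ => ?_
          rw [norm_smul, mul_pow, Complex.norm_real, Real.norm_eq_abs, sq_abs]
          gcongr
          exact single hG hβ a
      _ = G ^ 2 := by
          rw [Finset.sum_const, nsmul_eq_mul, Finset.card_univ, ← mul_assoc, hκ, one_mul]
  -- Cauchy–Schwarz against `φ` over pairs `(a, b)`. Only the columns `b ∈ P` survive, each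
  -- contributing at most `κ² F² G²`, and `|P| κ² = s²`.
  have hcross : ∑ a, (inner ℂ (v a) ((κ : ℂ) • β a)).re ≤ s * F * G := by
    have h1 : ∑ a, (inner ℂ (v a) ((κ : ℂ) • β a)).re ≤
        ∑ z : A × A, ‖φ z‖ * (if z.2 ∈ P then |κ| * ‖inner ℂ (α z.2) (β z.1)‖ else 0) := by
      rw [Fintype.sum_prod_type]
      refine Finset.sum_le_sum fun a _ => ?_
      refine (Complex.re_le_norm _).trans ?_
      rw [hv, sum_inner]
      refine (norm_sum_le _ _).trans (Finset.sum_le_sum fun b _ => ?_)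
      rw [inner_smul_left, inner_smul_right, norm_mul, norm_mul, Complex.norm_conj,
        Complex.norm_real, Real.norm_eq_abs]
      split_ifs with hb
      · exact le_rfl
      · simp [hP a b hb]
    have h2 := Finset.sum_mul_sq_le_sq_mul_sq Finset.univ (fun z : A × A => ‖φ z‖)
      (fun z : A × A => if z.2 ∈ P then |κ| * ‖inner ℂ (α z.2) (β z.1)‖ else 0)
    rw [Fintype.sum_prod_type (f := fun z : A × A => ‖φ z‖ ^ 2), hφ, one_mul] at h2
    have h3 : ∑ z : A × A, (if z.2 ∈ P then |κ| * ‖inner ℂ (α z.2) (β z.1)‖ else 0) ^ 2 ≤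
        (s * F * G) ^ 2 := by
      rw [Fintype.sum_prod_type, Finset.sum_comm]
      calc _ ≤ ∑ b, if b ∈ P then κ ^ 2 * (F * G) ^ 2 else 0 := by
            refine Finset.sum_le_sum fun b _ => ?_
            split_ifs with hb
            · simp only [mul_pow, sq_abs, ← Finset.mul_sum]
              gcongr
              refine (sum_norm_inner_sq_le hβ (α b)).trans ?_
              rw [mul_pow]
              gcongr
              exact single hF hα b
            · simp
        _ = (s * F * G) ^ 2 := by
            rw [Finset.sum_ite_mem, Finset.univ_inter, Finset.sum_const, nsmul_eq_mul,
              ← mul_assoc, hs]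
            ring
    exact h1.trans (abs_le_of_sq_le_sq' (h2.trans h3) (by positivity)).2
  have hsum : ∑ a, ‖v a + (κ : ℂ) • β a‖ ^ 2 ≤ (1 + s) * (F ^ 2 + G ^ 2) := by
    have (a : A) : ‖v a + (κ : ℂ) • β a‖ ^ 2 = ‖v a‖ ^ 2 +
        2 * (inner ℂ (v a) ((κ : ℂ) • β a)).re + ‖(κ : ℂ) • β a‖ ^ 2 :=
      norm_add_sq (𝕜 := ℂ) _ _
    simp_rw [this]
    rw [Finset.sum_add_distrib, Finset.sum_add_distrib, ← Finset.mul_sum]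
    nlinarith [mul_nonneg hs0 (sq_nonneg (F - G))]
  -- Cauchy–Schwarz against `u`; one factor `F² + G²` then cancels.
  have hcs : (F ^ 2 + G ^ 2) ^ 2 ≤ (∑ a, ‖u a‖ ^ 2) * ((1 + s) * (F ^ 2 + G ^ 2)) := by
    have h1 : F ^ 2 + G ^ 2 ≤ ∑ a, ‖u a‖ * ‖v a + (κ : ℂ) • β a‖ := by
      rw [hu]
      exact Finset.sum_le_sum fun a _ => (Complex.re_le_norm _).trans (norm_inner_le_norm _ _)
    have h2 := Finset.sum_mul_sq_le_sq_mul_sq Finset.univ (fun a => ‖u a‖)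
      (fun a => ‖v a + (κ : ℂ) • β a‖)
    calc _ ≤ (∑ a, ‖u a‖ * ‖v a + (κ : ℂ) • β a‖) ^ 2 := by gcongr
      _ ≤ _ := h2
      _ ≤ _ := by gcongr
  have hX : 0 ≤ F ^ 2 + G ^ 2 := by positivity
  rcases hX.eq_or_lt with h | h
  · rw [← h]; positivity
  · nlinarith

end Hilbert

/-! ### The overlap bound for dilated reveal operations -/

section Isometry

variable {M E : Type} [Fintype M] [Fintype E] [DecidableEq E]

theorem star_dotProduct_self (f : M → ℂ) : star f ⬝ᵥ f = ((∑ m, ‖f m‖ ^ 2 : ℝ) : ℂ) := by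
  simp [dotProduct, Complex.conj_mul']

/-- The adjoint of an isometry is a contraction. -/
theorem sum_norm_conjTranspose_mulVec_le [DecidableEq M] {V : Matrix M E ℂ}
    (hV : V.conjTranspose * V = 1)
    (f : M → ℂ) : ∑ e, ‖V.conjTranspose.mulVec f e‖ ^ 2 ≤ ∑ m, ‖f m‖ ^ 2 := by
  have hdot (N : Matrix E M ℂ) : star f ⬝ᵥ (N.conjTranspose * N).mulVec f =
      star (N.mulVec f) ⬝ᵥ N.mulVec f := by
    rw [← Matrix.mulVec_mulVec, Matrix.dotProduct_mulVec, Matrix.star_mulVec]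
  have hdot' (N : Matrix M M ℂ) : star f ⬝ᵥ (N.conjTranspose * N).mulVec f =
      star (N.mulVec f) ⬝ᵥ N.mulVec f := by
    rw [← Matrix.mulVec_mulVec, Matrix.dotProduct_mulVec, Matrix.star_mulVec]
  obtain ⟨Q, hQ⟩ : ∃ Q : Matrix M M ℂ, Q = 1 - V * V.conjTranspose := ⟨_, rfl⟩
  have hQQ : Q.conjTranspose * Q = 1 - V * V.conjTranspose := by
    have h1 : V * V.conjTranspose * (V * V.conjTranspose) = V * V.conjTranspose := by
      rw [Matrix.mul_assoc, ← Matrix.mul_assoc V.conjTranspose, hV, Matrix.one_mul]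
    simp [hQ, Matrix.sub_mul, Matrix.mul_sub, h1]
  have h2 := hdot' Q
  have h3 := hdot V.conjTranspose
  rw [hQQ, Matrix.sub_mulVec, dotProduct_sub, Matrix.one_mulVec] at h2
  rw [Matrix.conjTranspose_conjTranspose] at h3
  rw [h3, star_dotProduct_self, star_dotProduct_self, star_dotProduct_self, ← Complex.ofReal_sub,
    Complex.ofReal_inj] at h2
  have h4 : 0 ≤ ∑ m, ‖Q.mulVec f m‖ ^ 2 := Finset.sum_nonneg fun m _ => by positivity
  linarith

/-- The overlap bound for isometries `V₀ : E → A ⊗ G₀` and `V₁ : E → A ⊗ G₁`, a bipartite state `φ`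
whose second half is supported on `P`, and the maximally entangled state. -/
theorem sum_sq_isometry_le {A G₀ G₁ : Type} [Fintype A] [DecidableEq A] [Fintype G₀]
    [DecidableEq G₀] [Fintype G₁] [DecidableEq G₁] {V₀ : Matrix (A × G₀) E ℂ}
    {V₁ : Matrix (A × G₁) E ℂ} (hV₀ : V₀.conjTranspose * V₀ = 1)
    (hV₁ : V₁.conjTranspose * V₁ = 1) (φ : A × A → ℂ) (hφ : ∑ z, ‖φ z‖ ^ 2 = 1) (P : Finset A)
    (hP : ∀ a b, b ∉ P → φ (a, b) = 0) {κ s : ℝ} (hκ : Fintype.card A * κ ^ 2 = 1) (hs0 : 0 ≤ s)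
    (hs : P.card * κ ^ 2 = s ^ 2) (u : A → E → ℂ) :
    (∑ g, ‖∑ a, ∑ b, star (φ (a, b)) * V₀.mulVec (u a) (b, g)‖ ^ 2) +
      ∑ g, ‖∑ a, (κ : ℂ) * V₁.mulVec (u a) (a, g)‖ ^ 2 ≤ (1 + s) * ∑ a, ∑ e, ‖u a e‖ ^ 2 := by
  set f : G₀ → ℂ := fun g => ∑ a, ∑ b, star (φ (a, b)) * V₀.mulVec (u a) (b, g) with hf
  set k : G₁ → ℂ := fun g => ∑ a, (κ : ℂ) * V₁.mulVec (u a) (a, g) with hk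
  -- The vectors pulled back are `V* (δ_a ⊗ w)`. Their combination with coefficients `c` is `V* (c ⊗
  -- w)`, and `V*` is a contraction.
  have pull {G : Type} [Fintype G] [DecidableEq G] {V : Matrix (A × G) E ℂ}
      (hV : V.conjTranspose * V = 1) (w : G → ℂ) (c : A → ℂ) :
      ‖∑ a, c a • (WithLp.toLp 2 (V.conjTranspose.mulVec fun m => if m.1 = a then w m.2 else 0) :
        EuclideanSpace ℂ E)‖ ^ 2 ≤ (∑ a, ‖c a‖ ^ 2) * √(∑ g, ‖w g‖ ^ 2) ^ 2 := by
    have h1 : ∑ a, c a • (WithLp.toLp 2 (V.conjTranspose.mulVec fun m =>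
        if m.1 = a then w m.2 else 0) : EuclideanSpace ℂ E) =
        WithLp.toLp 2 (V.conjTranspose.mulVec fun m => c m.1 * w m.2) := by
      simp_rw [← WithLp.toLp_smul, ← Matrix.mulVec_smul]
      rw [← WithLp.toLp_sum, ← Matrix.mulVec_sum]
      congr 2
      funext m
      simp
    rw [h1, EuclideanSpace.norm_sq_eq, Real.sq_sqrt (Finset.sum_nonneg fun g _ => by positivity)]
    refine (sum_norm_conjTranspose_mulVec_le hV _).trans (le_of_eq ?_)
    rw [Fintype.sum_prod_type, Finset.sum_mul_sum]
    simp [mul_pow]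
  have hin {G : Type} [Fintype G] [DecidableEq G] (V : Matrix (A × G) E ℂ) (w : G → ℂ)
      (x : E → ℂ) (b : A) : inner ℂ (WithLp.toLp 2 x : EuclideanSpace ℂ E)
        (WithLp.toLp 2 (V.conjTranspose.mulVec fun m => if m.1 = b then w m.2 else 0)) =
        ∑ g, star (V.mulVec x (b, g)) * w g := by
    rw [EuclideanSpace.inner_toLp_toLp, dotProduct_comm, Matrix.dotProduct_mulVec,
      ← Matrix.star_mulVec, dotProduct, Fintype.sum_prod_type]
    simp only [mul_ite, mul_zero, Pi.star_apply]
    rw [Finset.sum_comm]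
    simp
  have hF2 : √(∑ g, ‖f g‖ ^ 2) ^ 2 = ∑ g, ‖f g‖ ^ 2 :=
    Real.sq_sqrt (Finset.sum_nonneg fun g _ => by positivity)
  have hK2 : √(∑ g, ‖k g‖ ^ 2) ^ 2 = ∑ g, ‖k g‖ ^ 2 :=
    Real.sq_sqrt (Finset.sum_nonneg fun g _ => by positivity)
  -- Here `F` and `G` are the norms of the components `f` and `k` themselves, so `F² + G²` is the
  -- inner product of `u` with the sum of the pullbacks of `φ ⊗ f` and of the maximally entangled
  -- state tensored with `k`.
  have main := sum_sq_le_of_overlap (Real.sqrt_nonneg (∑ g, ‖f g‖ ^ 2))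
    (Real.sqrt_nonneg (∑ g, ‖k g‖ ^ 2)) (pull hV₀ f) (pull hV₁ k) φ hφ P hP hκ hs0 hs
    (fun a => WithLp.toLp 2 (u a)) ?_
  · rw [hF2, hK2] at main
    simpa only [EuclideanSpace.norm_sq_eq] using main
  · rw [hF2, hK2]
    simp only [inner_add_right, inner_sum, inner_smul_right, hin, Complex.add_re,
      Finset.sum_add_distrib]
    congr 1
    · have : ((∑ g, ‖f g‖ ^ 2 : ℝ) : ℂ) = ∑ a, ∑ b, φ (a, b) *
          ∑ g, star (V₀.mulVec (u a) (b, g)) * f g := by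
        rw [← star_dotProduct_self, dotProduct]
        simp only [Pi.star_apply]
        conv_lhs => enter [2, g, 1]; rw [hf]
        simp only [star_sum, star_mul', star_star, Finset.sum_mul, Finset.mul_sum]
        rw [Finset.sum_comm]
        refine Finset.sum_congr rfl fun a _ => ?_
        rw [Finset.sum_comm]
        simp only [mul_assoc]
      rw [← Complex.ofReal_re (∑ g, ‖f g‖ ^ 2), this, Complex.re_sum]
    · have : ((∑ g, ‖k g‖ ^ 2 : ℝ) : ℂ) = ∑ a, (κ : ℂ) *
          ∑ g, star (V₁.mulVec (u a) (a, g)) * k g := by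
        rw [← star_dotProduct_self, dotProduct]
        simp only [Pi.star_apply]
        conv_lhs => enter [2, g, 1]; rw [hk]
        simp only [star_sum, star_mul', Complex.star_def, Complex.conj_ofReal, Finset.sum_mul,
          Finset.mul_sum]
        rw [Finset.sum_comm]
        simp only [mul_assoc]
      rw [← Complex.ofReal_re (∑ g, ‖k g‖ ^ 2), this, Complex.re_sum]

end Isometry

/-! ### Projecting a subset of the register pairs -/

section Tests

variable {κ X : Type} [DecidableEq κ]

/-- Combine the registers inside and outside `S`. -/
def glue (S : Finset κ) (a : {i // i ∈ S} → X) (c : {i // i ∉ S} → X) : κ → X :=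
  (Equiv.piEquivPiSubtypeProd (· ∈ S) fun _ => X).symm (a, c)

theorem glue_of_mem (S : Finset κ) (a : {i // i ∈ S} → X) (c : {i // i ∉ S} → X) {i : κ}
    (h : i ∈ S) : glue S a c i = a ⟨i, h⟩ := by
  simp [glue, Equiv.piEquivPiSubtypeProd, h]

theorem glue_of_notMem (S : Finset κ) (a : {i // i ∈ S} → X) (c : {i // i ∉ S} → X) {i : κ}
    (h : i ∉ S) : glue S a c i = c ⟨i, h⟩ := by
  simp [glue, Equiv.piEquivPiSubtypeProd, h]

theorem prod_glue (S : Finset κ) (F : X → X → X → X → ℂ) (a b a' b' : {i // i ∈ S} → X)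
    (c d c' d' : {i // i ∉ S} → X) :
    ∏ i ∈ S, F (glue S a c i) (glue S b d i) (glue S a' c' i) (glue S b' d' i) =
      ∏ i, F (a i) (b i) (a' i) (b' i) := by
  rw [← Finset.prod_coe_sort]
  exact Finset.prod_congr rfl fun i _ => by
    rw [glue_of_mem S a c i.2, glue_of_mem S b d i.2, glue_of_mem S a' c' i.2,
      glue_of_mem S b' d' i.2]

theorem prod_glue_compl [Fintype κ] [DecidableEq X] (S : Finset κ) (a b a' b' : {i // i ∈ S} → X)
    (c d c' d' : {i // i ∉ S} → X) :
    (∏ i ∈ Finset.univ \ S, if (glue S a c i, glue S b d i) = (glue S a' c' i, glue S b' d' i)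
      then (1 : ℂ) else 0) = if c = c' then if d = d' then 1 else 0 else 0 := by
  rw [Finset.prod_ite_zero, Finset.prod_const_one, ← ite_and]
  congr 1
  simp only [Finset.mem_sdiff, Finset.mem_univ, true_and, Prod.mk.injEq, eq_iff_iff]
  constructor
  · intro h
    constructor
    · funext ⟨i, hi⟩
      have := (h i hi).1
      rwa [glue_of_notMem S _ _ hi, glue_of_notMem S _ _ hi] at this
    · funext ⟨i, hi⟩
      have := (h i hi).2
      rwa [glue_of_notMem S _ _ hi, glue_of_notMem S _ _ hi] at this
  · rintro ⟨rfl, rfl⟩ i hi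
    simp [glue_of_notMem S _ _ hi]

variable [Fintype κ] [Fintype X]

theorem sum_glue {R : Type} [AddCommMonoid R] (S : Finset κ) (F : (κ → X) → R) :
    ∑ x, F x = ∑ c, ∑ a, F (glue S a c) := by
  rw [← (Equiv.piEquivPiSubtypeProd (· ∈ S) fun _ => X).symm.sum_comp, Fintype.sum_prod_type,
    Finset.sum_comm]
  rfl

/-- The weight of `w` on the states that agree with `ψ` on the registers in `S`. -/
def overlap (ψ : X × X → ℂ) (S : Finset κ) (w : (κ → X) × (κ → X) → ℂ) : ℝ :=
  ∑ c : {i // i ∉ S} → X, ∑ d : {i // i ∉ S} → X,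
    ‖∑ a : {i // i ∈ S} → X, ∑ b : {i // i ∈ S} → X,
      star (∏ i, ψ (a i, b i)) * w (glue S a c, glue S b d)‖ ^ 2

variable [DecidableEq X]

/-- The operator is `|ψ⟩⟨ψ|` on the pairs in `S` and the identity elsewhere. The identity makes the
outside labels agree, and for each of them a squared modulus remains. -/
theorem sum_quadratic_eq_overlap (ψ : X × X → ℂ) (S : Finset κ) (w : (κ → X) × (κ → X) → ℂ) :
    ∑ z, ∑ z', w z * star (w z') * ((∏ i ∈ S, ψ (z'.1 i, z'.2 i) * star (ψ (z.1 i, z.2 i))) *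
      ∏ i ∈ Finset.univ \ S, if (z.1 i, z.2 i) = (z'.1 i, z'.2 i) then 1 else 0) =
      (overlap ψ S w : ℂ) := by
  have hsplit (F : (κ → X) × (κ → X) → ℂ) : ∑ z, F z =
      ∑ c, ∑ d, ∑ a, ∑ b, F (glue S a c, glue S b d) := by
    rw [Fintype.sum_prod_type, sum_glue S]
    refine Finset.sum_congr rfl fun c _ => ?_
    rw [Finset.sum_comm (s := Finset.univ (α := {i // i ∉ S} → X))]
    exact Finset.sum_congr rfl fun a _ => sum_glue S fun y => F (glue S a c, y)
  rw [hsplit, overlap]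
  push_cast
  refine Finset.sum_congr rfl fun c _ => Finset.sum_congr rfl fun d _ => ?_
  set q := ∑ a : {i // i ∈ S} → X, ∑ b : {i // i ∈ S} → X,
    star (∏ i, ψ (a i, b i)) * w (glue S a c, glue S b d) with hq
  have hstar : star q = ∑ a : {i // i ∈ S} → X, ∑ b : {i // i ∈ S} → X,
      (∏ i, ψ (a i, b i)) * star (w (glue S a c, glue S b d)) := by
    rw [hq]
    simp only [star_sum, star_mul', star_star]
  have hin (a b : {i // i ∈ S} → X) :
      ∑ z', w (glue S a c, glue S b d) * star (w z') *
        ((∏ i ∈ S, ψ (z'.1 i, z'.2 i) * star (ψ (glue S a c i, glue S b d i))) *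
        ∏ i ∈ Finset.univ \ S, if (glue S a c i, glue S b d i) = (z'.1 i, z'.2 i) then 1 else 0) =
      star (∏ i, ψ (a i, b i)) * w (glue S a c, glue S b d) * star q := by
    rw [hsplit, hstar]
    simp only [prod_glue S (fun x y x' y' => ψ (x', y') * star (ψ (x, y))), prod_glue_compl]
    simp only [mul_ite, mul_one, mul_zero, Finset.sum_ite_irrel, Finset.sum_const_zero,
      Finset.sum_ite_eq, Finset.mem_univ, if_true]
    rw [Finset.mul_sum]
    refine Finset.sum_congr rfl fun a' _ => ?_
    rw [Finset.mul_sum]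
    refine Finset.sum_congr rfl fun b' _ => ?_
    rw [Finset.prod_mul_distrib, star_prod]
    ring
  simp only [hin, ← Finset.sum_mul]
  rw [← hq, Complex.star_def, Complex.mul_conj']

/-- The isometry bound is applied for each value of the `C` registers outside `S`, on which the
reveal channels do not act. Cardinalities and amplitudes of the `S`-fold product are powers, so `s`
becomes `s ^ S.card`. -/
theorem overlap_sum_le {E : Type} [Fintype E] [DecidableEq E] (K₀ K₁ : Channel E (κ → X))
    (ψ₀ ψ₁ : X × X → ℂ) (h₀ : ∑ z, ‖ψ₀ z‖ ^ 2 = 1) (P : Finset X)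
    (hP : ∀ x y, y ∉ P → ψ₀ (x, y) = 0) {k s : ℝ}
    (h₁ : ∀ x y, ψ₁ (x, y) = if x = y then (k : ℂ) else 0) (hk : Fintype.card X * k ^ 2 = 1)
    (hs0 : 0 ≤ s) (hs : P.card * k ^ 2 = s ^ 2) (S : Finset κ) (u : (κ → X) × E → ℂ) :
    (∑ j, overlap ψ₀ S fun z => ∑ e, K₀.kraus j z.2 e * u (z.1, e)) +
      (∑ j, overlap ψ₁ S fun z => ∑ e, K₁.kraus j z.2 e * u (z.1, e)) ≤
      (1 + s ^ S.card) * ∑ z, ‖u z‖ ^ 2 := by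
  -- The Stinespring dilation: the environment consists of the Kraus index and the `R` registers
  -- outside `S`.
  let V (K : Channel E (κ → X)) :
      Matrix (({i // i ∈ S} → X) × (Fin K.rank × ({i // i ∉ S} → X))) E ℂ :=
    Matrix.of fun m e => K.kraus m.2.1 (glue S m.1 m.2.2) e
  have hV (K : Channel E (κ → X)) : (V K).conjTranspose * V K = 1 := by
    rw [← K.trace_preserving]
    ext e e'
    simp only [V, Matrix.mul_apply, Matrix.sum_apply, Matrix.conjTranspose_apply, Matrix.of_apply,
      Fintype.sum_prod_type]
    rw [Finset.sum_comm]
    refine Finset.sum_congr rfl fun j _ => ?_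
    rw [sum_glue S, Finset.sum_comm]
  have hcard : Fintype.card {i // i ∈ S} = S.card := by simp
  let φ : ({i // i ∈ S} → X) × ({i // i ∈ S} → X) → ℂ := fun z => ∏ i, ψ₀ (z.1 i, z.2 i)
  have hφ : ∑ z, ‖φ z‖ ^ 2 = 1 := by
    rw [Fintype.sum_prod_type]
    simp only [φ, norm_prod, ← Finset.prod_pow]
    have h2 := Finset.prod_univ_sum
      (fun _ : {i // i ∈ S} => (Finset.univ : Finset (X × X))) (fun _ x => ‖ψ₀ x‖ ^ 2)
    rw [Fintype.piFinset_univ] at h2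
    simp only [h₀, Finset.prod_const_one] at h2
    rw [h2, ← (Equiv.arrowProdEquivProdArrow {i // i ∈ S} (fun _ => X) fun _ => X).symm.sum_comp,
      Fintype.sum_prod_type]
    rfl
  let Q : Finset ({i // i ∈ S} → X) := Fintype.piFinset fun _ => P
  have hQ (a b : {i // i ∈ S} → X) (hb : b ∉ Q) : φ (a, b) = 0 := by
    simp only [Q, Fintype.mem_piFinset, not_forall] at hb
    obtain ⟨i, hi⟩ := hb
    exact Finset.prod_eq_zero (Finset.mem_univ i) (hP _ _ hi)
  have hκ : Fintype.card ({i // i ∈ S} → X) * (k ^ S.card) ^ 2 = 1 := by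
    rw [Fintype.card_fun, hcard]
    push_cast
    rw [← pow_mul, mul_comm S.card, pow_mul, ← mul_pow, hk, one_pow]
  have hsQ : Q.card * (k ^ S.card) ^ 2 = (s ^ S.card) ^ 2 := by
    rw [Fintype.card_piFinset, Finset.prod_const, Finset.card_univ, hcard]
    push_cast
    rw [← pow_mul, mul_comm S.card, pow_mul, ← mul_pow, hs, ← pow_mul, ← pow_mul, mul_comm]
  have main (c : {i // i ∉ S} → X) := sum_sq_isometry_le (hV K₀) (hV K₁) φ hφ Q hQ hκ
    (pow_nonneg hs0 _) hsQ fun a e => u (glue S a c, e)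
  have hsum := Finset.sum_le_sum fun c (_ : c ∈ Finset.univ) => main c
  rw [Finset.sum_add_distrib, ← Finset.mul_sum] at hsum
  have hu : ∑ c : {i // i ∉ S} → X, ∑ a, ∑ e, ‖u (glue S a c, e)‖ ^ 2 = ∑ z, ‖u z‖ ^ 2 := by
    rw [Fintype.sum_prod_type, sum_glue S]
  rw [hu] at hsum
  refine le_trans (le_of_eq ?_) hsum
  congr 1
  · simp only [overlap, Fintype.sum_prod_type]
    rw [Finset.sum_comm]
    rfl
  · simp only [overlap, Fintype.sum_prod_type]
    rw [Finset.sum_comm]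
    refine Finset.sum_congr rfl fun c _ => Finset.sum_congr rfl fun j _ =>
      Finset.sum_congr rfl fun d _ => ?_
    have hψ (a b : {i // i ∈ S} → X) :
        star (∏ i, ψ₁ (a i, b i)) = if a = b then ((k ^ S.card : ℝ) : ℂ) else 0 := by
      simp only [h₁]
      rw [Finset.prod_ite_zero]
      simp [funext_iff, apply_ite (starRingEnd ℂ)]
    simp only [hψ, ite_mul, zero_mul, Finset.sum_ite_eq, Finset.mem_univ, if_true]
    rfl

end Tests

/-! ### Sum-binding -/

/-- Expanding `∏ (1 + |ψ⟩⟨ψ|)/2` chooses, for each `i`, either the identity or the projector; `S`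
collects the projectors. -/
theorem acceptProb_eq_sum_overlap {l n : ℕ} (h : l ≤ n) (b : Bool) (θ : PureState n) {ι : Type}
    [Fintype ι] (w : ι → Reg l n × Reg l n → ℂ) :
    acceptProb l b θ (Matrix.of fun z z' => ∑ i, w i z * star (w i z')) =
      ∑ S : Finset (Fin l), (2⁻¹ : ℝ) ^ l * ∑ i, overlap (psi l b θ) S (w i) := by
  rw [acceptProb_eq h]
  have hexp (z z' : Reg l n × Reg l n) : ∏ i, ((2⁻¹ : ℂ) *
      ((if (z.1 i, z.2 i) = (z'.1 i, z'.2 i) then 1 else 0) +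
        psi l b θ (z'.1 i, z'.2 i) * star (psi l b θ (z.1 i, z.2 i)))) =
      ∑ S : Finset (Fin l), (2⁻¹ : ℂ) ^ l *
        ((∏ i ∈ S, psi l b θ (z'.1 i, z'.2 i) * star (psi l b θ (z.1 i, z.2 i))) *
          ∏ i ∈ Finset.univ \ S, if (z.1 i, z.2 i) = (z'.1 i, z'.2 i) then 1 else 0) := by
    rw [Finset.prod_mul_distrib, Finset.prod_const, Finset.card_univ, Fintype.card_fin]
    simp_rw [add_comm (ite _ _ _)]
    rw [Finset.prod_add, Finset.powerset_univ, Finset.mul_sum]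
  have hval : ∑ z, ∑ z', (Matrix.of fun z z' => ∑ i, w i z * star (w i z')) z z' *
      ∏ i, ((2⁻¹ : ℂ) * ((if (z.1 i, z.2 i) = (z'.1 i, z'.2 i) then 1 else 0) +
        psi l b θ (z'.1 i, z'.2 i) * star (psi l b θ (z.1 i, z.2 i)))) =
      ((∑ S : Finset (Fin l), (2⁻¹ : ℝ) ^ l * ∑ i, overlap (psi l b θ) S (w i) : ℝ) : ℂ) := by
    push_cast
    simp only [← sum_quadratic_eq_overlap, hexp, Matrix.of_apply, Finset.mul_sum, Finset.sum_mul]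
    calc _ = ∑ z : Reg l n × Reg l n, ∑ S : Finset (Fin l), ∑ i, ∑ z' : Reg l n × Reg l n,
          w i z * star (w i z') * ((2⁻¹ : ℂ) ^ l *
        ((∏ i ∈ S, psi l b θ (z'.1 i, z'.2 i) * star (psi l b θ (z.1 i, z.2 i))) *
          ∏ i ∈ Finset.univ \ S, if (z.1 i, z.2 i) = (z'.1 i, z'.2 i) then 1 else 0)) := by
          refine Finset.sum_congr rfl fun z _ => ?_
          rw [Finset.sum_comm]
          refine Finset.sum_congr rfl fun S _ => ?_
          rw [Finset.sum_comm]
      _ = _ := by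
          rw [Finset.sum_comm]
          refine Finset.sum_congr rfl fun S _ => ?_
          rw [Finset.sum_comm]
          refine Finset.sum_congr rfl fun i _ => Finset.sum_congr rfl fun z _ =>
            Finset.sum_congr rfl fun z' _ => ?_
          ring
  rw [hval, Complex.ofReal_re]

/-- The vectors after the commit phase, one for each Kraus operator. -/
def MaliciousPair.commitVec {l n T : ℕ} (M : MaliciousPair l n T) (θ : PureState n)
    (i : Fin M.commit.rank) : Reg l n × Fin M.dim → ℂ :=
  (M.commit.kraus i).mulVec (copies T θ.amp)

theorem MaliciousPair.state_eq {l n T : ℕ} (M : MaliciousPair l n T) (b : Bool)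
    (θ : PureState n) : M.state b θ = Matrix.of fun z z' =>
      ∑ m : Fin M.commit.rank × Fin (M.reveal b).rank,
        (∑ e, (M.reveal b).kraus m.2 z.2 e * M.commitVec θ m.1 (z.1, e)) *
          star (∑ e, (M.reveal b).kraus m.2 z'.2 e * M.commitVec θ m.1 (z'.1, e)) := by
  have h1 : M.commit.apply (ketbra (copies T θ.amp)) = ∑ i, ketbra (M.commitVec θ i) := by
    refine Finset.sum_congr rfl fun i _ => ?_
    rw [ketbra, Matrix.mul_vecMulVec, Matrix.vecMulVec_mul, ketbra, MaliciousPair.commitVec,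
      Matrix.star_mulVec]
  have h2 (N : Matrix (Reg l n) (Fin M.dim) ℂ) (v : Reg l n × Fin M.dim → ℂ) :
      ((1 : Matrix (Reg l n) (Reg l n) ℂ) ⊗ₖ N) * ketbra v *
        ((1 : Matrix (Reg l n) (Reg l n) ℂ) ⊗ₖ N).conjTranspose =
      Matrix.of fun z z' => (∑ e, N z.2 e * v (z.1, e)) * star (∑ e, N z'.2 e * v (z'.1, e)) := by
    have h3 : ((1 : Matrix (Reg l n) (Reg l n) ℂ) ⊗ₖ N).mulVec v =
        fun z => ∑ e, N z.2 e * v (z.1, e) := by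
      funext z
      simp [Matrix.mulVec, dotProduct, Matrix.kroneckerMap_apply, Fintype.sum_prod_type,
        Matrix.one_apply]
    rw [ketbra, Matrix.mul_vecMulVec, Matrix.vecMulVec_mul, ← Matrix.star_mulVec, h3]
    rfl
  rw [MaliciousPair.state, Channel.applyRight, h1]
  simp only [Matrix.mul_sum, Matrix.sum_mul, h2]
  ext z z'
  rw [Matrix.of_apply, Fintype.sum_prod_type, Finset.sum_comm]
  simp only [Matrix.sum_apply, Matrix.of_apply]

theorem MaliciousPair.sum_norm_commitVec {l n T : ℕ} (M : MaliciousPair l n T)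
    (θ : PureState n) : ∑ i, ∑ z, ‖M.commitVec θ i z‖ ^ 2 = 1 := by
  have h1 (i : Fin M.commit.rank) : ((∑ z, ‖M.commitVec θ i z‖ ^ 2 : ℝ) : ℂ) =
      star (copies T θ.amp) ⬝ᵥ
        ((M.commit.kraus i).conjTranspose * M.commit.kraus i).mulVec (copies T θ.amp) := by
    rw [← star_dotProduct_self, MaliciousPair.commitVec, ← Matrix.mulVec_mulVec,
      Matrix.dotProduct_mulVec _ _ (Matrix.mulVec _ _), Matrix.star_mulVec]
  have h2 : ((∑ i, ∑ z, ‖M.commitVec θ i z‖ ^ 2 : ℝ) : ℂ) = 1 := by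
    rw [Complex.ofReal_sum]
    simp only [h1]
    rw [← dotProduct_sum, ← Matrix.sum_mulVec, M.commit.trace_preserving, Matrix.one_mulVec,
      star_dotProduct_self]
    have h3 := Finset.prod_univ_sum (fun _ : Fin T => (Finset.univ : Finset (Qubits n)))
      (fun _ x => ‖θ.amp x‖ ^ 2)
    rw [Fintype.piFinset_univ] at h3
    simp only [sum_norm_amp_sq, Finset.prod_const_one] at h3
    simp only [copies, norm_prod, ← Finset.prod_pow]
    rw [← h3, Complex.ofReal_one]
  exact_mod_cast h2

theorem acceptProb_add_le {l n T : ℕ} (h : l ≤ n) (M : MaliciousPair l n T) (θ : PureState n) :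
    acceptProb l false θ (M.state false θ) + acceptProb l true θ (M.state true θ) ≤
      1 + ((1 + (2 : ℝ) ^ (-((n : ℝ) - (l : ℝ)) / 2)) / 2) ^ l := by
  set s : ℝ := (2 : ℝ) ^ (-((n : ℝ) - (l : ℝ)) / 2) with hs
  have hs0 : 0 ≤ s := by positivity
  set k : ℝ := 1 / √(2 ^ n) with hk
  have hk2 : k ^ 2 = ((2 : ℝ) ^ n)⁻¹ := by
    rw [hk, div_pow, Real.sq_sqrt (by positivity), one_pow, one_div]
  have hs2 : s ^ 2 = 2 ^ l * ((2 : ℝ) ^ n)⁻¹ := by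
    rw [hs, ← Real.rpow_natCast, ← Real.rpow_mul (by norm_num), ← Real.rpow_natCast 2 l,
      ← Real.rpow_natCast 2 n, ← Real.rpow_neg (by norm_num), ← Real.rpow_add (by norm_num)]
    congr 1
    push_cast
    ring
  have hψ0 : ∑ z, ‖psi l false θ z‖ ^ 2 = 1 := by
    have := psi_norm h false θ
    simp only [Complex.star_def, Complex.mul_conj'] at this
    exact_mod_cast this
  -- The second half of `ψ₀` is supported on the `2^l` padded keys, whence `s² = 2^l / 2^n`.
  have hP (x y : Qubits n) (hy : y ∉ Finset.univ.image (pad n : Qubits l → Qubits n)) :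
      psi l false θ (x, y) = 0 := by
    simp only [Finset.mem_image, Finset.mem_univ, true_and, not_exists] at hy
    simp only [psi, Bool.false_eq_true, if_false, psi0_apply]
    rw [Finset.sum_eq_zero fun k _ => if_neg fun hh => hy k hh.symm, mul_zero]
  have hbound (i : Fin M.commit.rank) (S : Finset (Fin l)) :=
    overlap_sum_le (M.reveal false) (M.reveal true) (psi l false θ) (psi l true θ) hψ0 _ hP
      (k := k) (s := s) (fun x y => by simp only [psi, if_true, psi1_apply, hk])
      (by rw [hk2]; simp) hs0
      (by rw [hk2, hs2, Finset.card_image_of_injective _ (pad_injective h)]; simp)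
      S (M.commitVec θ i)
  rw [M.state_eq, M.state_eq, acceptProb_eq_sum_overlap h, acceptProb_eq_sum_overlap h,
    ← Finset.sum_add_distrib]
  calc _ ≤ ∑ S : Finset (Fin l), (2⁻¹ : ℝ) ^ l * (1 + s ^ S.card) := by
        refine Finset.sum_le_sum fun S _ => ?_
        rw [← mul_add]
        refine mul_le_mul_of_nonneg_left ?_ (by positivity)
        rw [Fintype.sum_prod_type, Fintype.sum_prod_type, ← Finset.sum_add_distrib]
        refine (Finset.sum_le_sum fun i _ => hbound i S).trans (le_of_eq ?_)
        rw [← Finset.mul_sum, M.sum_norm_commitVec, mul_one]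
    _ = 1 + ((1 + s) / 2) ^ l := by
        -- The binomial theorem, `∑_S s^{|S|} = (1 + s)^l`.
        have h1 := Fintype.sum_pow_mul_eq_add_pow (Fin l) s 1
        simp only [one_pow, mul_one, Fintype.card_fin] at h1
        rw [← Finset.mul_sum, Finset.sum_add_distrib, h1, Finset.sum_const, Finset.card_univ,
          Fintype.card_finset, Fintype.card_fin, div_pow, add_comm s 1, mul_add, inv_pow]
        simp
        ring

theorem continuous_acceptProb {l n T : ℕ} (h : l ≤ n) (M : MaliciousPair l n T) (b : Bool) :
    Continuous fun θ : PureState n => acceptProb l b θ (M.state b θ) := by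
  simp only [acceptProb_eq h, M.state_eq, Matrix.of_apply]
  have hv (i) (z) : Continuous fun θ : PureState n => M.commitVec θ i z := by
    simp only [MaliciousPair.commitVec, Matrix.mulVec, dotProduct, copies]
    fun_prop
  have hψ (z) : Continuous fun θ : PureState n => psi l b θ z := continuous_psi l b z
  fun_prop

theorem bindingProb_add_le {l n T : ℕ} (h : l ≤ n) (M : MaliciousPair l n T) :
    bindingProb M false + bindingProb M true ≤
      1 + ((1 + (2 : ℝ) ^ (-((n : ℝ) - (l : ℝ)) / 2)) / 2) ^ l := by
  rw [bindingProb, bindingProb, ← integral_add (integrable_haar (continuous_acceptProb h M false))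
    (integrable_haar (continuous_acceptProb h M true))]
  refine (integral_mono ((integrable_haar (continuous_acceptProb h M false)).add
    (integrable_haar (continuous_acceptProb h M true))) (integrable_const _)
    fun θ => acceptProb_add_le h M θ).trans (le_of_eq ?_)
  simp

theorem statisticallySumBinding {n : ℕ → ℕ} (hn : ∀ l, l + 1 ≤ n l) :
    StatisticallySumBinding n := by
  intro T M
  -- The extra qubit, `n - l ≥ 1`, bounds `s` by `2^{-1/2}` for every `l`, so the base of the power
  -- stays uniformly below 1.
  have hr : (2 : ℝ) ^ (-(1 : ℝ) / 2) < 1 :=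
    Real.rpow_lt_one_of_one_lt_of_neg (by norm_num) (by norm_num)
  have hr0 : (0 : ℝ) ≤ 2 ^ (-(1 : ℝ) / 2) := by positivity
  refine ⟨_, negligible_pow (r := (1 + (2 : ℝ) ^ (-(1 : ℝ) / 2)) / 2) (by linarith)
    (by linarith), fun l => (bindingProb_add_le (Nat.le_of_succ_le (hn l)) (M l)).trans ?_⟩
  have hl : (l : ℝ) + 1 ≤ n l := by exact_mod_cast hn l
  gcongr
  · norm_num
  · linarith

end

end CHS

theorem mainTheorem4 (n : ℕ → ℕ) (hn : ∀ l, l + 1 ≤ n l) :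
    CHS.PolyCopyStatisticallyHiding n ∧
    CHS.StatisticallySumBinding n ∧
    ∀ (l T : ℕ) (M : CHS.MaliciousPair l (n l) T),
      CHS.bindingProb M false + CHS.bindingProb M true ≤
        1 + ((1 + (2 : ℝ) ^ (-((n l : ℝ) - (l : ℝ)) / 2)) / 2) ^ l :=
  ⟨CHS.polyCopyStatisticallyHiding fun l => Nat.le_of_succ_le (hn l),
    CHS.statisticallySumBinding hn,
    fun l _ M => CHS.bindingProb_add_le (Nat.le_of_succ_le (hn l)) M⟩
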